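/- Let $\Omega\subset\mathbb{R}^2$ be a bounded open set (for instance a bounded domain), $X_0=L^2(\Omega)\times L^2(\Omega)$ and $X_1=H^1(\Omega)\times H^1(\Omega)$. Let $D:\mathbb{R}^2\to M_{2\times2}(\mathbb{R})$ satisfy (H1) there is $\alpha>0$ with $\xi^TD(y)\xi\ge\alpha|\xi|^2$ for all $y,\xi\in\mathbb{R}^2$; (H2) there is $L>0$ with $|D_{ij}(z)-D_{ij}(y)|\le L|z-y|$ for all $y,z\in\mathbb{R}^2$, $i,j=1,2$; (H3) there is $M>0$ with $|D_{ij}(y)|\le M$ for all $y\in\mathbb{R}^2$, $i,j=1,2$. For $T>0$ and ${\bf u}_0\in X_0$, a weak solution on $[0,T]$, with initial datum ${\bf u}_0$, of the cross-diffusion system $$\partial_t u=\operatorname{div}(D_{11}({\bf u})\nabla u+D_{12}({\bf u})\nabla v),\qquad \partial_t v=\operatorname{div}(D_{21}({\bf u})\nabla u+D_{22}({\bf u})\nabla v)$$ in $\Omega\times(0,T]$ with homogeneous Neumann (no-flux) boundary conditions is a function ${\bf u}=(u,v)^T\in C([0,T];X_0)\cap L^2(0,T;X_1)$ with $\partial_t{\bf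 u}\in L^2(0,T;(X_1)')$, ${\bf u}(0)={\bf u}_0$ and, for almost every $t\in(0,T)$, $$\langle\partial_t{\bf u}(t),{\bf w}\rangle+\int_\Omega\operatorname{tr}\big((J{\bf w})^TD({\bf u}(t))\,J{\bf u}(t)\big)\,d\Omega=0\qquad\text{for all }{\bf w}\in X_1,$$ where $J$ denotes the Jacobian matrix. Assume in addition that $D(y+{\bf C})=D(y)$ for all $y,{\bf C}\in\mathbb{R}^2$. Then the scale-space operator $T_t$, $t\ge0$, which maps ${\bf u}_0\in X_0$ to the value ${\bf u}(t)$ of the weak solution with initial datum ${\bf u}_0$, is well defined: for every ${\bf u}_0\in X_0$ and $T>0$, the function $t\mapsto T_t({\bf u}_0)$ is the unique weak solution on $[0,T]$ with initial datum ${\bf u}_0$. Moreover it is invariant under grey-level shifts: for all $t\ge0$, ${\bf u}_0\in X_0$ and ${\bf C}\in\mathbb{R}^2$ (identified with a constant function), $$T_t({\bf 0})={\bf 0},\qquad T_t({\bf u}_0+{\bf C})=T_t({\bf u}_0)+{\bf C}.$$ -/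

import Mathlib

open MeasureTheory Set
open scoped ContDiff

noncomputable section

namespace CrossDiffusion

/-- The Euclidean plane; it serves both as the space of the points `x` and as the space of the
values `(u, v)`. -/
abbrev Plane : Type := EuclideanSpace ℝ (Fin 2)

/-- `L²(Ω)`. -/
abbrev L2 (Ω : Set Plane) : Type := Lp ℝ 2 (volume.restrict Ω)

/-- The partial derivative `∂φ/∂x_k` of a smooth function. -/
def partialDeriv (k : Fin 2) (φ : Plane → ℝ) (x : Plane) : ℝ :=
  fderiv ℝ φ x (EuclideanSpace.single k 1)

/-- `φ` belongs to `C_c^∞(Ω)`. -/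
structure IsTestFunction (Ω : Set Plane) (φ : Plane → ℝ) : Prop where
  smooth : ContDiff ℝ ∞ φ
  compact : HasCompactSupport φ
  support : tsupport φ ⊆ Ω

/-- `g` is the weak partial derivative `∂u/∂x_k` in `Ω`. -/
def IsWeakPartial (Ω : Set Plane) (k : Fin 2) (u g : L2 Ω) : Prop :=
  ∀ φ : Plane → ℝ, IsTestFunction Ω φ →
    ∫ x in Ω, u x * partialDeriv k φ x = - ∫ x in Ω, g x * φ x

lemma IsTestFunction.integrable_mul {Ω : Set Plane} {φ : Plane → ℝ} (hφ : IsTestFunction Ω φ)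
    (g : L2 Ω) : Integrable (fun x => g x * φ x) (volume.restrict Ω) :=
  (Lp.memLp g).integrable_mul (q := 2)
    ((hφ.smooth.continuous.memLp_of_hasCompactSupport hφ.compact).restrict Ω)

lemma IsTestFunction.integrable_mul_partialDeriv {Ω : Set Plane} {φ : Plane → ℝ}
    (hφ : IsTestFunction Ω φ) (k : Fin 2) (g : L2 Ω) :
    Integrable (fun x => g x * partialDeriv k φ x) (volume.restrict Ω) := by
  have hc : Continuous (partialDeriv k φ) :=
    (hφ.smooth.continuous_fderiv (by simp)).clm_apply continuous_const
  have hs : HasCompactSupport (partialDeriv k φ) :=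
    hφ.compact.fderiv_apply ℝ (EuclideanSpace.single k 1)
  exact (Lp.memLp g).integrable_mul (q := 2) ((hc.memLp_of_hasCompactSupport hs).restrict Ω)

/-- The Sobolev space `H¹(Ω)`: its elements are written `(u, (∂u/∂x_0, ∂u/∂x_1))`, and its norm is
`(‖u‖² + ‖∂u/∂x_0‖² + ‖∂u/∂x_1‖²)^(1/2)`. -/
def H1 (Ω : Set Plane) : Submodule ℝ (WithLp 2 (L2 Ω × PiLp 2 fun _ : Fin 2 => L2 Ω)) where
  carrier := {p | ∀ k, IsWeakPartial Ω k p.fst (p.snd k)}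
  zero_mem' := by
    intro k φ _
    have key : ∀ ψ : Plane → ℝ, ∫ x in Ω, (0 : L2 Ω) x * ψ x = 0 := by
      intro ψ
      rw [integral_congr_ae (g := fun _ => (0 : ℝ))
        ((Lp.coeFn_zero ℝ 2 (volume.restrict Ω)).mono fun x hx => by
          beta_reduce; rw [hx, Pi.zero_apply, zero_mul])]
      simp
    change ∫ x in Ω, (0 : L2 Ω) x * partialDeriv k φ x = - ∫ x in Ω, (0 : L2 Ω) x * φ x
    rw [key, key, neg_zero]
  add_mem' := by
    intro p q hp hq k φ hφ
    have key : ∀ (a b : L2 Ω) (ψ : Plane → ℝ),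
        Integrable (fun x => a x * ψ x) (volume.restrict Ω) →
        Integrable (fun x => b x * ψ x) (volume.restrict Ω) →
        ∫ x in Ω, (a + b : L2 Ω) x * ψ x = (∫ x in Ω, a x * ψ x) + ∫ x in Ω, b x * ψ x := by
      intro a b ψ ha hb
      rw [← integral_add ha hb]
      exact integral_congr_ae ((Lp.coeFn_add a b).mono fun x hx => by
        beta_reduce; rw [hx, Pi.add_apply, add_mul])
    have e1 := key p.fst q.fst _ (hφ.integrable_mul_partialDeriv k _)
      (hφ.integrable_mul_partialDeriv k _)
    have e2 := key (p.snd k) (q.snd k) _ (hφ.integrable_mul _) (hφ.integrable_mul _)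
    change ∫ x in Ω, (p.fst + q.fst : L2 Ω) x * partialDeriv k φ x
      = - ∫ x in Ω, (p.snd k + q.snd k : L2 Ω) x * φ x
    rw [e1, e2, hp k φ hφ, hq k φ hφ, neg_add]
  smul_mem' := by
    intro c p hp k φ hφ
    have key : ∀ (a : L2 Ω) (ψ : Plane → ℝ),
        ∫ x in Ω, (c • a : L2 Ω) x * ψ x = c * ∫ x in Ω, a x * ψ x := by
      intro a ψ
      rw [← integral_const_mul]
      exact integral_congr_ae ((Lp.coeFn_smul c a).mono fun x hx => by simp [hx, mul_assoc])
    change ∫ x in Ω, (c • p.fst : L2 Ω) x * partialDeriv k φ x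
      = - ∫ x in Ω, (c • p.snd k : L2 Ω) x * φ x
    rw [key, key, hp k φ hφ, mul_neg]

/-- `X₀ = L²(Ω) × L²(Ω)` with the Hilbert norm `(‖u‖² + ‖v‖²)^(1/2)`. -/
abbrev X0 (Ω : Set Plane) : Type := PiLp 2 fun _ : Fin 2 => L2 Ω

/-- `X₁ = H¹(Ω) × H¹(Ω)` with the Hilbert norm `(‖u‖₁² + ‖v‖₁²)^(1/2)`. -/
abbrev X1 (Ω : Set Plane) : Type := PiLp 2 fun _ : Fin 2 => H1 Ω

-- Shortcuts to Mathlib's instances on `X₁`, for faster instance search.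
instance (Ω : Set Plane) : NormedAddCommGroup (X1 Ω) := PiLp.normedAddCommGroup 2 _

instance (Ω : Set Plane) : NormedSpace ℝ (X1 Ω) := PiLp.normedSpace 2 ℝ _

instance (Ω : Set Plane) : InnerProductSpace ℝ (X1 Ω) := PiLp.innerProductSpace _

/-- The inclusion of `X₁` in `X₀`. -/
def X1.toX0 {Ω : Set Plane} (u : X1 Ω) : X0 Ω := WithLp.toLp 2 fun i => (u i).1.fst

/-- The value at `x` of (a representative of) an element of `X₀`. -/
def X0.val {Ω : Set Plane} (u : X0 Ω) (x : Plane) : Plane := WithLp.toLp 2 fun i => u i x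

/-- The Jacobian matrix of an element of `X₁`, with entry `∂u_i/∂x_k` in row `i`, column `k`. -/
def X1.jacobian {Ω : Set Plane} (u : X1 Ω) (x : Plane) : Matrix (Fin 2) (Fin 2) ℝ :=
  Matrix.of fun i k => (u i).1.snd k x

/-- `∫_Ω tr((Jw)ᵀ D(u) (Ju)) dx`. -/
def diffusionForm {Ω : Set Plane} (D : Plane → Matrix (Fin 2) (Fin 2) ℝ) (u w : X1 Ω) : ℝ :=
  ∫ x in Ω, ((w.jacobian x).transpose * D (u.toX0.val x) * u.jacobian x).trace

/-- `f : (0,T) → (X₁)'` is the weak time derivative of `u : (0,T) → X₀`, where `X₀` is viewed in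
`(X₁)'` through the scalar product of `X₀`. -/
def IsWeakTimeDeriv {Ω : Set Plane} (T : ℝ) (u : ℝ → X0 Ω) (f : ℝ → StrongDual ℝ (X1 Ω)) : Prop :=
  ∀ φ : ℝ → ℝ, ContDiff ℝ ∞ φ → HasCompactSupport φ → tsupport φ ⊆ Ioo 0 T → ∀ w : X1 Ω,
    ∫ t in Ioo 0 T, deriv φ t * inner ℝ (u t) w.toX0 = - ∫ t in Ioo 0 T, φ t * f t w

/-- `u : [0,T] → X₀` is a weak solution of the system `∂_t u = div (D(u) ∇u)` in `Ω × (0,T]` with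
homogeneous Neumann (no-flux) boundary condition and initial datum `u₀`:
`u ∈ C([0,T]; X₀) ∩ L²(0,T; X₁)`, `∂_t u ∈ L²(0,T; (X₁)')`, `u(0) = u₀` and
`⟨∂_t u, w⟩ + ∫_Ω tr((Jw)ᵀ D(u) (Ju)) dx = 0` for almost every `t` and all `w ∈ X₁`.
The function `v` is `u` seen as a function with values in `X₁`. -/
structure IsWeakSolution {Ω : Set Plane} (D : Plane → Matrix (Fin 2) (Fin 2) ℝ) (T : ℝ)
    (u₀ : X0 Ω) (u : ℝ → X0 Ω) : Prop where
  continuousOn : ContinuousOn u (Icc 0 T)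
  initial : u 0 = u₀
  weak : ∃ (v : ℝ → X1 Ω) (f : ℝ → StrongDual ℝ (X1 Ω)),
    MemLp v 2 (volume.restrict (Ioo 0 T)) ∧
    (∀ᵐ t ∂volume.restrict (Ioo 0 T), (v t).toX0 = u t) ∧
    MemLp f 2 (volume.restrict (Ioo 0 T)) ∧
    IsWeakTimeDeriv T u f ∧
    ∀ᵐ t ∂volume.restrict (Ioo 0 T), ∀ w : X1 Ω, f t w + diffusionForm D (v t) w = 0

open Classical in
/-- The scale-space operator `T_t`: it maps `u₀` to the value at time `t` of the weak solution with
initial datum `u₀`, a weak solution for all times `t ≥ 0` being one on every interval `[0,T]`.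
(It is set to `0` where no weak solution exists.) -/
def scaleSpace {Ω : Set Plane} (D : Plane → Matrix (Fin 2) (Fin 2) ℝ) (t : ℝ) (u₀ : X0 Ω) : X0 Ω :=
  if h : ∃ u : ℝ → X0 Ω, ∀ T : ℝ, 0 < T → IsWeakSolution D T u₀ u then h.choose t else 0

lemma memLp_const_of_isBounded {Ω : Set Plane} (hΩ : Bornology.IsBounded Ω) (c : ℝ) :
    MemLp (fun _ : Plane => c) 2 (volume.restrict Ω) :=
  haveI : IsFiniteMeasure (volume.restrict Ω) := isFiniteMeasure_restrict.2 hΩ.measure_lt_top.ne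
  memLp_const c

/-- The constant vector `C ∈ ℝ²` as an element of `X₀`, for a bounded `Ω`. -/
def constField {Ω : Set Plane} (hΩ : Bornology.IsBounded Ω) (C : Plane) : X0 Ω :=
  WithLp.toLp 2 fun i => (memLp_const_of_isBounded hΩ (C i)).toLp (fun _ => C i)

end CrossDiffusion

end

open MeasureTheory Set
open scoped ContDiff

noncomputable section

namespace CrossDiffusion

open Filter Topology

set_option linter.unusedSectionVars false

/-! Shift invariance makes `D` equal to the single matrix `D 0 = A`, so the system is linear: `d/dt
(u, j w) + a u w = 0` for a bounded form `a`, generally nonsymmetric, with `j : X₁ → X₀` the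
inclusion. (H1) controls gradients only, whence coercivity up to the norm of `H`.

Existence is proved for any `GelfandForm`. Lax–Milgram gives the resolvents `R` and hence bounded
Yosida approximations, whose exponentials are contractions of `H`. For data `j v` with `a v` bounded
in the norm of `H`, the approximations are Cauchy in `H` and, by coercivity, their resolvents are
Cauchy in `V`, uniformly on `[0, T]`. Such data are dense (`exists_regular_near`), and contraction
together with the energy bound `IsResolvent.integral_norm_sq_le` carries convergence over to all
data, in `C([0,T]; H)` and `L²(0,T; V)` (`exists_isWeakSol`).

Uniqueness (`IsWeakSol.eq_zero`) smooths a solution by the resolvent, so that the energy argument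
concerns a differentiable function of time.

Constants have zero gradient and are admissible in `X₁`, as no boundary value is imposed; they are
stationary solutions. Linearity and uniqueness then give the invariance under shifts. -/

/-- A bounded bilinear form `a` on a Hilbert space `V` that is densely and contractively mapped into
a Hilbert space `H`, coercive up to the norm of `H`. -/
structure GelfandForm (V H : Type*) [NormedAddCommGroup V] [InnerProductSpace ℝ V]
    [NormedAddCommGroup H] [InnerProductSpace ℝ H] where
  /-- the embedding -/
  j : V →L[ℝ] H
  /-- the form -/
  a : V →L[ℝ] V →L[ℝ] ℝ
  /-- the coercivity constant -/
  α : ℝ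
  α_pos : 0 < α
  norm_j_le : ∀ v, ‖j v‖ ≤ ‖v‖
  coercive : ∀ v, α * (‖v‖ ^ 2 - ‖j v‖ ^ 2) ≤ a v v
  eq_zero_of_inner : ∀ h : H, (∀ w, inner ℝ h (j w) = 0) → h = 0

/-! ### Resolvents and Yosida approximations of a coercive form -/

namespace GelfandForm

variable {V H : Type*} [NormedAddCommGroup V] [InnerProductSpace ℝ V] [CompleteSpace V]
  [NormedAddCommGroup H] [InnerProductSpace ℝ H] [CompleteSpace H] (P : GelfandForm V H)

lemma form_self_nonneg (v : V) : 0 ≤ P.a v v := by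
  refine le_trans (mul_nonneg P.α_pos.le ?_) (P.coercive v)
  have := pow_le_pow_left₀ (norm_nonneg _) (P.norm_j_le v) 2
  linarith

/-- `R` solves `j v + l * a v = h` for every `h`. -/
def IsResolvent (l : ℝ) (R : H →L[ℝ] V) : Prop :=
  ∀ h w, inner ℝ (P.j (R h)) (P.j w) + l * P.a (R h) w = inner ℝ h (P.j w)

/-- The form `(j v, j w) + l * a v w`. -/
def shifted (l : ℝ) : V →L[ℝ] V →L[ℝ] ℝ :=
  (isBoundedBilinearMap_inner (𝕜 := ℝ) (E := H)).toContinuousLinearMap.bilinearComp P.j P.j + l • P.a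

lemma shifted_apply (l : ℝ) (v w : V) :
    P.shifted l v w = inner ℝ (P.j v) (P.j w) + l * P.a v w := by
  simp [shifted]

/-- The term `‖j v‖²` supplies exactly what the coercivity of `a` lacks, so every `l > 0` is
admissible. -/
lemma isCoercive_shifted {l : ℝ} (hl : 0 < l) : IsCoercive (P.shifted l) := by
  have hα := mul_pos hl P.α_pos
  refine ⟨min 1 (l * P.α), lt_min one_pos hα, fun v => ?_⟩
  rw [shifted_apply, real_inner_self_eq_norm_sq]
  have h1 := mul_le_mul_of_nonneg_left (P.coercive v) hl.le
  have h2 := pow_le_pow_left₀ (norm_nonneg _) (P.norm_j_le v) 2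
  have h3 := mul_le_mul_of_nonneg_right (min_le_left 1 (l * P.α)) (sq_nonneg ‖P.j v‖)
  have h4 := mul_le_mul_of_nonneg_right (min_le_right 1 (l * P.α)) (sub_nonneg.2 h2)
  nlinarith

lemma exists_isResolvent {l : ℝ} (hl : 0 < l) : ∃ R, P.IsResolvent l R := by
  have hc := P.isCoercive_shifted hl
  refine ⟨(hc.continuousLinearEquivOfBilin.symm : V →L[ℝ] V) ∘L P.j.adjoint, fun h w => ?_⟩
  rw [← shifted_apply, ← hc.continuousLinearEquivOfBilin_apply]
  simp [ContinuousLinearMap.adjoint_inner_left]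

/-- Solvability of the adjoint problem. -/
lemma exists_adjoint_solution {l : ℝ} (hl : 0 < l) (g : H) :
    ∃ w : V, ∀ v, inner ℝ (P.j v) (P.j w) + l * P.a v w = inner ℝ (P.j v) g := by
  have hc := P.isCoercive_shifted hl
  refine ⟨(hc.continuousLinearEquivOfBilin.symm : V →L[ℝ] V).adjoint (P.j.adjoint g),
    fun v => ?_⟩
  rw [← shifted_apply, ← hc.continuousLinearEquivOfBilin_apply]
  simp [ContinuousLinearMap.adjoint_inner_right]

/-- The Yosida approximation. -/
def yosida (l : ℝ) (R : H →L[ℝ] V) : H →L[ℝ] H := l⁻¹ • (1 - P.j ∘L R)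

/-- The semigroup generated by the Yosida approximation. -/
def flow (l : ℝ) (R : H →L[ℝ] V) (t : ℝ) : H →L[ℝ] H := NormedSpace.exp (t • (-P.yosida l R))

section

variable {P} {l : ℝ} {R : H →L[ℝ] V}

lemma smul_yosida (hl : 0 < l) (h : H) : l • P.yosida l R h = h - P.j (R h) := by
  simp [yosida, smul_smul, hl.ne']

/-- Writing `a` as an operator `A`, this is `A R = A_l`: the Yosida approximation represents `a (R
h)` by a vector of `H`. -/
lemma IsResolvent.form_eq (hR : P.IsResolvent l R) (hl : 0 < l) (h : H) (w : V) :
    P.a (R h) w = inner ℝ (P.yosida l R h) (P.j w) := by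
  have h1 := hR h w
  have h2 : l * inner ℝ (P.yosida l R h) (P.j w) = inner ℝ h (P.j w) - inner ℝ (P.j (R h)) (P.j w) := by
    rw [← inner_sub_left, ← smul_yosida hl, inner_smul_left]; simp
  exact mul_left_cancel₀ hl.ne' (by linarith)

lemma IsResolvent.inner_yosida_self (hR : P.IsResolvent l R) (hl : 0 < l) (h : H) :
    inner ℝ (P.yosida l R h) h = P.a (R h) (R h) + l * ‖P.yosida l R h‖ ^ 2 := by
  have : h = P.j (R h) + l • P.yosida l R h := by rw [smul_yosida hl]; abel
  calc inner ℝ (P.yosida l R h) h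
      = inner ℝ (P.yosida l R h) (P.j (R h) + l • P.yosida l R h) := by rw [← this]
    _ = _ := by
      rw [inner_add_right, inner_smul_right, real_inner_self_eq_norm_sq, hR.form_eq hl]

lemma IsResolvent.inner_yosida_self_nonneg (hR : P.IsResolvent l R) (hl : 0 < l) (h : H) :
    0 ≤ inner ℝ (P.yosida l R h) h := by
  rw [hR.inner_yosida_self hl]
  have := P.form_self_nonneg (R h)
  positivity

lemma IsResolvent.norm_le (hR : P.IsResolvent l R) (hl : 0 < l) (h : H) :
    ‖P.j (R h)‖ ≤ ‖h‖ := by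
  have h1 := hR h (R h)
  have h2 := P.form_self_nonneg (R h)
  have h3 := real_inner_le_norm h (P.j (R h))
  rw [real_inner_self_eq_norm_sq] at h1
  have h4 := mul_nonneg hl.le h2
  by_contra! h5
  nlinarith [norm_nonneg h]

lemma hasDerivAt_flow (t : ℝ) (h : H) :
    HasDerivAt (fun s => P.flow l R s h) (-P.yosida l R (P.flow l R t h)) t := by
  have := (hasDerivAt_exp_smul_const' (𝕂 := ℝ) (-P.yosida l R) t).clm_apply (hasDerivAt_const t h)
  simpa [flow] using this

lemma continuous_flow (h : H) : Continuous fun s => P.flow l R s h :=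
  continuous_iff_continuousAt.2 fun t => (hasDerivAt_flow t h).continuousAt

@[simp] lemma flow_zero (h : H) : P.flow l R 0 h = h := by simp [flow]

lemma yosida_flow (t : ℝ) (h : H) :
    P.yosida l R (P.flow l R t h) = P.flow l R t (P.yosida l R h) := by
  have : Commute (P.yosida l R) (P.flow l R t) :=
    (((Commute.refl (P.yosida l R)).neg_right).smul_right t).exp_right
  exact congrArg (fun A : H →L[ℝ] H => A h) this.eq

lemma hasDerivAt_norm_sq_flow (t : ℝ) (h : H) :
    HasDerivAt (fun s => ‖P.flow l R s h‖ ^ 2)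
      (-(2 * inner ℝ (P.yosida l R (P.flow l R t h)) (P.flow l R t h))) t := by
  have := (hasDerivAt_flow (P := P) (l := l) (R := R) t h).norm_sq
  rw [inner_neg_right, real_inner_comm] at this
  convert this using 1; ring

lemma IsResolvent.norm_flow_le (hR : P.IsResolvent l R) (hl : 0 < l) {t : ℝ} (ht : 0 ≤ t) (h : H) :
    ‖P.flow l R t h‖ ≤ ‖h‖ := by
  have hanti : Antitone fun s => ‖P.flow l R s h‖ ^ 2 := by
    refine antitone_of_hasDerivAt_nonpos (fun s => hasDerivAt_norm_sq_flow s h) fun s => ?_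
    have := hR.inner_yosida_self_nonneg hl (P.flow l R s h)
    change -_ ≤ (0 : ℝ)
    linarith
  have := hanti ht
  simp only [flow_zero] at this
  exact (sq_le_sq₀ (norm_nonneg _) (norm_nonneg _)).1 this

/-- The decay of `‖u‖²` bounds the integral of `(A_l u, u) ≥ a (R u) (R u)` by `‖h‖² / 2`. The part
of `‖R u‖²` missed by coercivity is at most `‖h‖²` at each time, which accounts for the summand `T`.
-/
lemma IsResolvent.integral_norm_sq_le (hR : P.IsResolvent l R) (hl : 0 < l) {T : ℝ} (hT : 0 ≤ T)
    (h : H) :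
    ∫ t in (0 : ℝ)..T, ‖R (P.flow l R t h)‖ ^ 2 ≤ (1 / (2 * P.α) + T) * ‖h‖ ^ 2 := by
  have hα := P.α_pos
  have hc := continuous_flow (P := P) (l := l) (R := R) h
  have hc' : Continuous fun t => inner ℝ (P.yosida l R (P.flow l R t h)) (P.flow l R t h) :=
    ((P.yosida l R).continuous.comp hc).inner hc
  have h1 : ∫ t in (0 : ℝ)..T, -(2 * inner ℝ (P.yosida l R (P.flow l R t h)) (P.flow l R t h))
      = ‖P.flow l R T h‖ ^ 2 - ‖h‖ ^ 2 := by
    rw [intervalIntegral.integral_eq_sub_of_hasDerivAt (fun t _ => hasDerivAt_norm_sq_flow t h)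
      ((continuous_const.mul hc').neg.intervalIntegrable _ _), flow_zero]
  rw [intervalIntegral.integral_neg, intervalIntegral.integral_const_mul] at h1
  have h2 : ∫ t in (0 : ℝ)..T, ‖R (P.flow l R t h)‖ ^ 2
      ≤ ∫ t in (0 : ℝ)..T, (P.α⁻¹ * inner ℝ (P.yosida l R (P.flow l R t h)) (P.flow l R t h)
        + ‖h‖ ^ 2) := by
    refine intervalIntegral.integral_mono_on hT
      (((R.continuous.comp hc).norm.pow 2).intervalIntegrable _ _)
      (((continuous_const.mul hc').add continuous_const).intervalIntegrable _ _) fun t ht => ?_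
    have e1 := P.coercive (R (P.flow l R t h))
    have e2 := hR.inner_yosida_self hl (P.flow l R t h)
    have e3 : ‖P.j (R (P.flow l R t h))‖ ^ 2 ≤ ‖h‖ ^ 2 :=
      pow_le_pow_left₀ (norm_nonneg _)
        ((hR.norm_le hl _).trans (hR.norm_flow_le hl ht.1 h)) 2
    have e4 : 0 ≤ l * ‖P.yosida l R (P.flow l R t h)‖ ^ 2 := by positivity
    have e5 : ‖R (P.flow l R t h)‖ ^ 2 - ‖P.j (R (P.flow l R t h))‖ ^ 2 ≤
        P.α⁻¹ * inner ℝ (P.yosida l R (P.flow l R t h)) (P.flow l R t h) := by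
      rw [← div_eq_inv_mul, le_div_iff₀' hα]; linarith
    linarith
  refine h2.trans ?_
  have hi : IntervalIntegrable (fun t => P.α⁻¹ * inner ℝ (P.yosida l R (P.flow l R t h))
      (P.flow l R t h)) volume 0 T := (continuous_const.mul hc').intervalIntegrable _ _
  rw [intervalIntegral.integral_add hi
    (continuous_const.intervalIntegrable _ _), intervalIntegral.integral_const_mul,
    intervalIntegral.integral_const, smul_eq_mul, sub_zero, add_mul]
  refine add_le_add_left ?_ _
  rw [inv_mul_le_iff₀ hα]
  have : P.α * (1 / (2 * P.α) * ‖h‖ ^ 2) = ‖h‖ ^ 2 / 2 := by field_simp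
  rw [this]
  linarith [sq_nonneg ‖P.flow l R T h‖]

/-- With `x = A_l (j v)`, positivity of `a` at `v - R (j v)`, whose image under `j` is `l x`, reads
`0 ≤ l (g - x, x)`. The bound does not depend on `l`. -/
lemma IsResolvent.norm_yosida_le (hR : P.IsResolvent l R) (hl : 0 < l) {v : V} {g : H}
    (hg : ∀ w, P.a v w = inner ℝ g (P.j w)) : ‖P.yosida l R (P.j v)‖ ≤ ‖g‖ := by
  have h1 : P.j (v - R (P.j v)) = l • P.yosida l R (P.j v) := by rw [smul_yosida hl, map_sub]
  have h2 := P.form_self_nonneg (v - R (P.j v))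
  have h3 : P.a (v - R (P.j v)) (v - R (P.j v))
      = inner ℝ (g - P.yosida l R (P.j v)) (P.j (v - R (P.j v))) := by
    rw [inner_sub_left, ← hg, ← hR.form_eq hl]; simp
  rw [h3, h1, inner_smul_right, inner_sub_left, real_inner_self_eq_norm_sq] at h2
  have h4 := nonneg_of_mul_nonneg_right h2 hl
  have h5 := real_inner_le_norm g (P.yosida l R (P.j v))
  by_contra! h6
  nlinarith [norm_nonneg g]

variable {m : ℝ} {Q : H →L[ℝ] V}

/-- Split `u - z` into `j (R u - Q z)` and `l A_l u - m A_m z`. In the derivative of `‖u - z‖²` the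
first part contributes `-2 a ≤ 0`, and the second has norm at most `(l + m) ‖g‖`, since the flows
commute with their generators and contract. -/
lemma IsResolvent.norm_flow_sub_sq_le (hR : P.IsResolvent l R) (hl : 0 < l)
    (hQ : P.IsResolvent m Q) (hm : 0 < m) {v : V} {g : H}
    (hg : ∀ w, P.a v w = inner ℝ g (P.j w)) {t : ℝ} (ht : 0 ≤ t) :
    ‖P.flow l R t (P.j v) - P.flow m Q t (P.j v)‖ ^ 2 ≤ 4 * ‖g‖ ^ 2 * (l + m) * t := by
  set u := fun s => P.flow l R s (P.j v)
  set z := fun s => P.flow m Q s (P.j v)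
  have hd : ∀ s, HasDerivAt (fun s => ‖u s - z s‖ ^ 2 - 4 * ‖g‖ ^ 2 * (l + m) * s)
      (2 * inner ℝ (u s - z s) (-P.yosida l R (u s) - -P.yosida m Q (z s))
        - 4 * ‖g‖ ^ 2 * (l + m) * 1) s := fun s =>
    ((hasDerivAt_flow s _).sub (hasDerivAt_flow s _)).norm_sq.sub
      ((hasDerivAt_id s).const_mul _)
  have hanti : AntitoneOn (fun s => ‖u s - z s‖ ^ 2 - 4 * ‖g‖ ^ 2 * (l + m) * s) (Ici 0) := by
    refine antitoneOn_of_deriv_nonpos (convex_Ici 0)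
      (fun s _ => (hd s).continuousAt.continuousWithinAt)
      (fun s _ => (hd s).differentiableAt.differentiableWithinAt) fun s hs => ?_
    rw [interior_Ici] at hs
    rw [(hd s).deriv]
    have b1 : ‖P.yosida l R (u s)‖ ≤ ‖g‖ := by
      simp only [u]; rw [yosida_flow]
      exact (hR.norm_flow_le hl (le_of_lt hs) _).trans (hR.norm_yosida_le hl hg)
    have b2 : ‖P.yosida m Q (z s)‖ ≤ ‖g‖ := by
      simp only [z]; rw [yosida_flow]
      exact (hQ.norm_flow_le hm (le_of_lt hs) _).trans (hQ.norm_yosida_le hm hg)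
    have e1 : u s - z s = P.j (R (u s) - Q (z s))
        + (l • P.yosida l R (u s) - m • P.yosida m Q (z s)) := by
      rw [smul_yosida hl, smul_yosida hm, map_sub]; abel
    have e2 : inner ℝ (P.yosida l R (u s) - P.yosida m Q (z s)) (P.j (R (u s) - Q (z s)))
        = P.a (R (u s) - Q (z s)) (R (u s) - Q (z s)) := by
      rw [inner_sub_left, ← hR.form_eq hl, ← hQ.form_eq hm]; simp
    have e3 : inner ℝ (u s - z s) (-P.yosida l R (u s) - -P.yosida m Q (z s))
        = -P.a (R (u s) - Q (z s)) (R (u s) - Q (z s))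
          - inner ℝ (P.yosida l R (u s) - P.yosida m Q (z s))
            (l • P.yosida l R (u s) - m • P.yosida m Q (z s)) := by
      rw [← e2, sub_neg_eq_add, neg_add_eq_sub, ← neg_sub (P.yosida l R (u s)), inner_neg_right,
        real_inner_comm, e1, inner_add_right]
      ring
    have e4 := P.form_self_nonneg (R (u s) - Q (z s))
    have e5 := neg_le_of_abs_le (abs_real_inner_le_norm
      (P.yosida l R (u s) - P.yosida m Q (z s)) (l • P.yosida l R (u s) - m • P.yosida m Q (z s)))
    have e6 : ‖P.yosida l R (u s) - P.yosida m Q (z s)‖ ≤ 2 * ‖g‖ :=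
      (norm_sub_le _ _).trans (by linarith)
    have e7 : ‖l • P.yosida l R (u s) - m • P.yosida m Q (z s)‖ ≤ (l + m) * ‖g‖ := by
      refine (norm_sub_le _ _).trans ?_
      rw [norm_smul, norm_smul, Real.norm_of_nonneg hl.le, Real.norm_of_nonneg hm.le]
      nlinarith
    have e8 := mul_le_mul e6 e7 (norm_nonneg _) (by positivity)
    rw [e3]
    nlinarith
  have := hanti (mem_Ici.2 le_rfl) ht ht
  simp only [u, z, flow_zero, sub_self, norm_zero] at this
  linarith

/-- Coercivity turns closeness in `H` into closeness in `V`: `a` at `R u - Q z` equals `(A_l u - A_m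
z, j (R u - Q z)) ≤ 2 ‖g‖ ε`. -/
lemma IsResolvent.norm_resolvent_flow_sub_sq_le (hR : P.IsResolvent l R) (hl : 0 < l)
    (hQ : P.IsResolvent m Q) (hm : 0 < m) {v : V} {g : H}
    (hg : ∀ w, P.a v w = inner ℝ g (P.j w)) {t : ℝ} (ht : 0 ≤ t) {ε : ℝ}
    (hε : ‖P.flow l R t (P.j v) - P.flow m Q t (P.j v)‖ + (l + m) * ‖g‖ ≤ ε) :
    P.α * ‖R (P.flow l R t (P.j v)) - Q (P.flow m Q t (P.j v))‖ ^ 2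
      ≤ P.α * ε ^ 2 + 2 * ‖g‖ * ε := by
  set u := P.flow l R t (P.j v)
  set z := P.flow m Q t (P.j v)
  have b1 : ‖P.yosida l R u‖ ≤ ‖g‖ := by
    rw [yosida_flow]
    exact (hR.norm_flow_le hl ht _).trans (hR.norm_yosida_le hl hg)
  have b2 : ‖P.yosida m Q z‖ ≤ ‖g‖ := by
    rw [yosida_flow]
    exact (hQ.norm_flow_le hm ht _).trans (hQ.norm_yosida_le hm hg)
  have e1 : P.j (R u - Q z) = (u - z) - (l • P.yosida l R u - m • P.yosida m Q z) := by
    rw [smul_yosida hl, smul_yosida hm, map_sub]; abel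
  have e2 : inner ℝ (P.yosida l R u - P.yosida m Q z) (P.j (R u - Q z))
      = P.a (R u - Q z) (R u - Q z) := by
    rw [inner_sub_left, ← hR.form_eq hl, ← hQ.form_eq hm]; simp
  have e6 : ‖P.yosida l R u - P.yosida m Q z‖ ≤ 2 * ‖g‖ :=
    (norm_sub_le _ _).trans (by linarith)
  have e7 : ‖l • P.yosida l R u - m • P.yosida m Q z‖ ≤ (l + m) * ‖g‖ := by
    refine (norm_sub_le _ _).trans ?_
    rw [norm_smul, norm_smul, Real.norm_of_nonneg hl.le, Real.norm_of_nonneg hm.le]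
    nlinarith
  have e8 : ‖P.j (R u - Q z)‖ ≤ ε := by
    rw [e1]; exact (norm_sub_le _ _).trans (by linarith)
  have e9 := real_inner_le_norm (P.yosida l R u - P.yosida m Q z) (P.j (R u - Q z))
  have e10 := mul_le_mul e6 e8 (norm_nonneg _) (by positivity)
  have e11 := P.coercive (R u - Q z)
  have e12 := mul_le_mul_of_nonneg_left (pow_le_pow_left₀ (norm_nonneg _) e8 2) P.α_pos.le
  linarith

end

/-- The elements `j v` for which `a v` is bounded for the norm of `H` are dense in `H`. -/
lemma exists_regular_near (h : H) {ε : ℝ} (hε : 0 < ε) :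
    ∃ (v : V) (g : H), (∀ w, P.a v w = inner ℝ g (P.j w)) ∧ ‖h - P.j v‖ < ε := by
  obtain ⟨R, hR⟩ := P.exists_isResolvent one_pos
  have hdense : (LinearMap.range ((P.j ∘L R : H →L[ℝ] H) : H →ₗ[ℝ] H)).topologicalClosure = ⊤ := by
    rw [Submodule.topologicalClosure_eq_top_iff, Submodule.eq_bot_iff]
    -- For `g` orthogonal to the range, testing the equation of `R g` with `R g` gives `‖j (R g)‖² +
    -- a (R g) (R g) = 0`. Hence `R g = 0`, and then `g = 0`.
    intro g hg
    have h0 : inner ℝ g (P.j (R g)) = 0 := by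
      rw [real_inner_comm]; exact (Submodule.mem_orthogonal _ _).1 hg _ ⟨g, rfl⟩
    have h1 := hR g (R g)
    rw [h0, real_inner_self_eq_norm_sq, one_mul] at h1
    have h2 := P.form_self_nonneg (R g)
    have h3 := P.coercive (R g)
    have h4 : ‖P.j (R g)‖ ^ 2 = 0 := le_antisymm (by linarith) (sq_nonneg _)
    have h5 : ‖R g‖ ^ 2 = 0 := by
      refine le_antisymm ?_ (sq_nonneg _)
      rw [h4, sub_zero] at h3
      exact nonpos_of_mul_nonpos_right (h3.trans (by linarith)) P.α_pos
    have h6 : R g = 0 := by simpa using h5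
    refine P.eq_zero_of_inner g fun w => ?_
    rw [← hR g w, h6]; simp
  have hmem : h ∈ closure (LinearMap.range ((P.j ∘L R : H →L[ℝ] H) : H →ₗ[ℝ] H) : Set H) := by
    rw [← Submodule.topologicalClosure_coe, hdense]; trivial
  obtain ⟨_, ⟨k, rfl⟩, hk⟩ := Metric.mem_closure_iff.1 hmem ε hε
  refine ⟨R k, P.yosida 1 R k, hR.form_eq one_pos k, ?_⟩
  rw [← dist_eq_norm]; exact hk

end GelfandForm

/-! ### Weak derivatives in time -/

/-- A smooth function of integral zero with support in a compact interval has a primitive with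
support in the same interval. -/
lemma exists_primitive_with_support {θ : ℝ → ℝ} {a b : ℝ} (hθ : ContDiff ℝ ∞ θ)
    (hs : Function.support θ ⊆ Ioc a b) (h0 : ∫ t in a..b, θ t = 0) :
    ∃ φ : ℝ → ℝ, ContDiff ℝ ∞ φ ∧ deriv φ = θ ∧ Function.support φ ⊆ Icc a b := by
  have hd : ∀ t, HasDerivAt (fun t => ∫ s in a..t, θ s) (θ t) t := fun t =>
    intervalIntegral.integral_hasDerivAt_right (hθ.continuous.intervalIntegrable _ _)
      (hθ.continuous.stronglyMeasurableAtFilter _ _) hθ.continuous.continuousAt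
  have hd' : deriv (fun t => ∫ s in a..t, θ s) = θ := funext fun t => (hd t).deriv
  refine ⟨fun t => ∫ s in a..t, θ s, ?_, hd', ?_⟩
  · rw [contDiff_infty_iff_deriv, hd']
    exact ⟨fun t => (hd t).differentiableAt, hθ⟩
  · intro t ht
    have hz : ∀ s, s ∉ Ioc a b → θ s = 0 := fun s hs' => by
      by_contra h; exact hs' (hs h)
    by_contra hn
    apply ht
    rcases not_and_or.1 hn with h | h
    · have h := not_le.1 h
      dsimp only
      refine intervalIntegral.integral_zero_ae (Eventually.of_forall fun s hs' => ?_)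
      rw [uIoc_of_ge h.le] at hs'
      exact hz s fun h' => absurd h'.1 (not_lt.2 hs'.2)
    · have h := not_le.1 h
      dsimp only
      rw [← intervalIntegral.integral_add_adjacent_intervals (b := b)
        (hθ.continuous.intervalIntegrable _ _) (hθ.continuous.intervalIntegrable _ _), h0, zero_add]
      refine intervalIntegral.integral_zero_ae (Eventually.of_forall fun s hs' => ?_)
      rw [uIoc_of_le h.le] at hs'
      exact hz s fun h' => absurd h'.2 (not_le.2 hs'.1)

/-- The lemma of du Bois-Reymond: a continuous function whose weak derivative vanishes is
constant. -/
lemma eq_of_integral_deriv_smul_eq_zero {E : Type*} [NormedAddCommGroup E] [NormedSpace ℝ E]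
    [CompleteSpace E] {T : ℝ} (hT : 0 < T) {F : ℝ → E} (hF : ContinuousOn F (Icc 0 T))
    (h : ∀ φ : ℝ → ℝ, ContDiff ℝ ∞ φ → HasCompactSupport φ → tsupport φ ⊆ Ioo 0 T →
      ∫ t in Ioo 0 T, deriv φ t • F t = 0) :
    ∀ t ∈ Icc 0 T, F t = F 0 := by
  have hi : IntegrableOn F (Ioo 0 T) :=
    (hF.integrableOn_compact isCompact_Icc).mono_set Ioo_subset_Icc_self
  -- A fixed bump of integral 1: for each test function `ψ`, the difference `ψ - (∫ ψ) ρ` has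
  -- integral zero, hence is the derivative of a test function. This forces the constant to be `∫ ρ
  -- F`.
  obtain ⟨ρ, hρ1, hρ2, hρ3, hρ4⟩ : ∃ ρ : ℝ → ℝ, ContDiff ℝ ∞ ρ ∧ HasCompactSupport ρ ∧
      tsupport ρ ⊆ Ioo 0 T ∧ ∫ t, ρ t = 1 := by
    let f : ContDiffBump (T / 2) := ⟨T / 8, T / 4, by positivity, by linarith⟩
    refine ⟨f.normed volume, f.contDiff_normed, f.hasCompactSupport_normed, ?_, f.integral_normed⟩
    rw [f.tsupport_normed_eq, Real.closedBall_eq_Icc]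
    intro t ht
    constructor <;> [have := ht.1; have := ht.2] <;> simp only [f] at this <;> linarith
  set c := ∫ t in Ioo 0 T, ρ t • F t
  have hsm : ∀ {ψ : ℝ → ℝ}, Continuous ψ → IntegrableOn (fun t => ψ t • F t) (Ioo 0 T) := by
    intro ψ hψ
    exact ((hψ.continuousOn.smul hF).integrableOn_compact isCompact_Icc).mono_set Ioo_subset_Icc_self
  have hfull : ∀ {ψ : ℝ → ℝ}, tsupport ψ ⊆ Ioo 0 T → ∫ t in Ioo 0 T, ψ t = ∫ t, ψ t := fun hψ =>
    setIntegral_eq_integral_of_forall_compl_eq_zero fun t ht =>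
      image_eq_zero_of_notMem_tsupport fun h' => ht (hψ h')
  have hae : ∀ᵐ t, t ∈ Ioo 0 T → F t - c = 0 := by
    refine isOpen_Ioo.ae_eq_zero_of_integral_contDiff_smul_eq_zero
      ((hi.sub (integrableOn_const (by simp))).locallyIntegrableOn) fun ψ hψ1 hψ2 hψ3 => ?_
    set I := ∫ t, ψ t
    obtain ⟨a, b, ha, hb, hab⟩ : ∃ a b : ℝ, 0 < a ∧ b < T ∧ tsupport ψ ∪ tsupport ρ ⊆ Ioc a b := by
      have hK : IsCompact (tsupport ψ ∪ tsupport ρ) := hψ2.isCompact.union hρ2.isCompact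
      have hne : (tsupport ψ ∪ tsupport ρ).Nonempty := by
        refine Nonempty.inr (nonempty_iff_ne_empty.2 fun h' => ?_)
        rw [tsupport_eq_empty_iff] at h'
        simp [h'] at hρ4
      obtain ⟨a, ha, ha'⟩ := hK.exists_isLeast hne
      obtain ⟨b, hb, hb'⟩ := hK.exists_isGreatest hne
      have ha0 : 0 < a := (union_subset hψ3 hρ3 ha).1
      -- Halving the least point of the supports fits them into an interval open at its left end,
      -- still inside `(0, T)`.
      exact ⟨a / 2, b, half_pos ha0, (union_subset hψ3 hρ3 hb).2,
        fun t ht => ⟨(half_lt_self ha0).trans_le (ha' ht), hb' ht⟩⟩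
    have hsub : ∀ {χ : ℝ → ℝ}, tsupport χ ⊆ Ioc a b → ∫ t in a..b, χ t = ∫ t, χ t := fun hχ =>
      intervalIntegral.integral_eq_integral_of_support_subset ((subset_tsupport _).trans hχ)
    have hρi : IntervalIntegrable (fun t => I * ρ t) volume a b :=
      (continuous_const.mul hρ1.continuous).intervalIntegrable _ _
    have hFi : IntegrableOn (fun t => I • ρ t • F t) (Ioo 0 T) := (hsm hρ1.continuous).smul I
    obtain ⟨φ, hφ1, hφ2, hφ3⟩ := exists_primitive_with_support (a := a) (b := b)
      (θ := fun t => ψ t - I * ρ t) (hψ1.sub (contDiff_const.mul hρ1)) (fun t ht => by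
        by_contra hn
        refine ht ?_
        have h1 : ψ t = 0 := image_eq_zero_of_notMem_tsupport fun h' => hn (hab (Or.inl h'))
        have h2 : ρ t = 0 := image_eq_zero_of_notMem_tsupport fun h' => hn (hab (Or.inr h'))
        simp [h1, h2]) (by
        rw [intervalIntegral.integral_sub (hψ1.continuous.intervalIntegrable _ _)
          hρi,
          intervalIntegral.integral_const_mul, hsub (subset_union_left.trans hab),
          hsub (subset_union_right.trans hab), hρ4]
        simp [I])
    have hts : tsupport φ ⊆ Icc a b := closure_minimal hφ3 isClosed_Icc
    have h0 := h φ hφ1 (HasCompactSupport.of_support_subset_isCompact isCompact_Icc hφ3)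
      (hts.trans fun t ht => ⟨ha.trans_le ht.1, ht.2.trans_lt hb⟩)
    rw [hφ2] at h0
    simp only [sub_smul, mul_smul] at h0
    rw [integral_sub (hsm hψ1.continuous) hFi, integral_smul] at h0
    have h1 : ∫ t, ψ t • (F t - c) = ∫ t in Ioo 0 T, ψ t • (F t - c) :=
      (setIntegral_eq_integral_of_forall_compl_eq_zero fun t ht => by
        rw [image_eq_zero_of_notMem_tsupport fun h' => ht (hψ3 h'), zero_smul]).symm
    rw [h1]
    simp only [smul_sub]
    rw [integral_sub (hsm hψ1.continuous)
      ((hψ1.continuous.integrable_of_hasCompactSupport hψ2).integrableOn.smul_const c),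
      integral_smul_const, hfull hψ3]
    exact h0
  have hae' : F =ᵐ[volume.restrict (Ioo 0 T)] fun _ => c := by
    rw [EventuallyEq, ae_restrict_iff' measurableSet_Ioo]
    exact hae.mono fun t ht h' => sub_eq_zero.1 (ht h')
  have heq : EqOn F (fun _ => c) (Ioo 0 T) :=
    Measure.eqOn_open_of_ae_eq hae' isOpen_Ioo (hF.mono Ioo_subset_Icc_self) continuousOn_const
  have heq' : EqOn F (fun _ => c) (Icc 0 T) :=
    heq.of_subset_closure hF continuousOn_const Ioo_subset_Icc_self
      (by rw [closure_Ioo hT.ne])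
  intro t ht
  rw [heq' ht, heq' (left_mem_Icc.2 hT.le)]

lemma memLp_Ioo_of_continuous {E : Type*} [NormedAddCommGroup E] {f : ℝ → E} (hf : Continuous f)
    (T : ℝ) : MemLp f 2 (volume.restrict (Ioo 0 T)) := by
  obtain ⟨C, hC⟩ := isCompact_Icc.exists_bound_of_continuousOn (hf.continuousOn (s := Icc 0 T))
  refine MemLp.of_bound hf.aestronglyMeasurable C ?_
  exact (ae_restrict_mem measurableSet_Ioo).mono fun t ht => hC t (Ioo_subset_Icc_self ht)

lemma integral_Ioo_deriv_smul_add {E : Type*} [NormedAddCommGroup E] [NormedSpace ℝ E]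
    [CompleteSpace E] {T : ℝ} (hT : 0 < T) {φ : ℝ → ℝ} (hφ : ContDiff ℝ ∞ φ)
    (hs : tsupport φ ⊆ Ioo 0 T) {K k : ℝ → E} (hK : ∀ t, HasDerivAt K (k t) t)
    (hk : Continuous k) : ∫ t in Ioo 0 T, (deriv φ t • K t + φ t • k t) = 0 := by
  have hz : ∀ t, t ∉ Ioo 0 T → φ t = 0 := fun t ht =>
    image_eq_zero_of_notMem_tsupport fun h => ht (hs h)
  have hKc : Continuous K := continuous_iff_continuousAt.2 fun t => (hK t).continuousAt
  have hφ' : Continuous (deriv φ) := hφ.continuous_deriv (by simp)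
  rw [← integral_Ioc_eq_integral_Ioo, ← intervalIntegral.integral_of_le hT.le]
  have := intervalIntegral.integral_eq_sub_of_hasDerivAt (a := 0) (b := T)
    (f := fun t => φ t • K t) (f' := fun t => φ t • k t + deriv φ t • K t)
    (fun t _ => ((hφ.differentiable (by simp)) t).hasDerivAt.smul (hK t))
    (((hφ.continuous.smul hk).add (hφ'.smul hKc)).intervalIntegrable _ _)
  rw [hz 0 (by simp), hz T (by simp), zero_smul, zero_smul, sub_zero] at this
  rw [← this]
  simp only [add_comm]

/-! ### Abstract weak solutions and their uniqueness -/

namespace GelfandForm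

variable {V H : Type*} [NormedAddCommGroup V] [InnerProductSpace ℝ V] [CompleteSpace V]
  [NormedAddCommGroup H] [InnerProductSpace ℝ H] [CompleteSpace H] (P : GelfandForm V H)

/-- Weak solutions on `[0, T]` of `d/dt (u, j w) + a u w = 0` with initial datum `u₀`. -/
structure IsWeakSol (T : ℝ) (u₀ : H) (u : ℝ → H) : Prop where
  continuousOn : ContinuousOn u (Icc 0 T)
  initial : u 0 = u₀
  weak : ∃ v : ℝ → V, MemLp v 2 (volume.restrict (Ioo 0 T)) ∧
    (∀ᵐ t ∂volume.restrict (Ioo 0 T), P.j (v t) = u t) ∧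
    ∀ φ : ℝ → ℝ, ContDiff ℝ ∞ φ → HasCompactSupport φ → tsupport φ ⊆ Ioo 0 T → ∀ w : V,
      ∫ t in Ioo 0 T, deriv φ t * inner ℝ (u t) (P.j w) = ∫ t in Ioo 0 T, φ t * P.a (v t) w

variable {P}

lemma integrable_mul_inner {T : ℝ} {u : ℝ → H} (hu : ContinuousOn u (Icc 0 T)) {ψ : ℝ → ℝ}
    (hψ : Continuous ψ) (h : H) : IntegrableOn (fun t => ψ t * inner ℝ (u t) h) (Ioo 0 T) :=
  ((hψ.continuousOn.mul (hu.inner continuousOn_const)).integrableOn_compact isCompact_Icc).mono_set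
    Ioo_subset_Icc_self

lemma integrable_mul_form {T : ℝ} {v : ℝ → V} (hv : MemLp v 2 (volume.restrict (Ioo 0 T)))
    {φ : ℝ → ℝ} (hφ : Continuous φ) (w : V) :
    IntegrableOn (fun t => φ t * P.a (v t) w) (Ioo 0 T) :=
  (memLp_Ioo_of_continuous hφ T).integrable_mul (q := 2) ((P.a.flip w).comp_memLp' hv)

lemma IsWeakSol.add_smul {T : ℝ} {u₀ z₀ : H} {u z : ℝ → H} (hu : P.IsWeakSol T u₀ u)
    (hz : P.IsWeakSol T z₀ z) (c : ℝ) :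
    P.IsWeakSol T (u₀ + c • z₀) (fun t => u t + c • z t) := by
  obtain ⟨v, hv1, hv2, hv3⟩ := hu.weak
  obtain ⟨y, hy1, hy2, hy3⟩ := hz.weak
  refine ⟨hu.continuousOn.add (hz.continuousOn.const_smul c), by rw [hu.initial, hz.initial],
    fun t => v t + c • y t, hv1.add (hy1.const_smul c), ?_, fun φ h1 h2 h3 w => ?_⟩
  · filter_upwards [hv2, hy2] with t e1 e2
    rw [map_add, map_smul, e1, e2]
  · have hφ' : Continuous (deriv φ) := h1.continuous_deriv (by simp)
    have e1 : ∀ t, deriv φ t * inner ℝ (u t + c • z t) (P.j w)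
        = deriv φ t * inner ℝ (u t) (P.j w) + c * (deriv φ t * inner ℝ (z t) (P.j w)) := fun t => by
      rw [inner_add_left, real_inner_smul_left]; ring
    have e2 : ∀ t, φ t * P.a (v t + c • y t) w
        = φ t * P.a (v t) w + c * (φ t * P.a (y t) w) := fun t => by
      simp only [map_add, map_smul, _root_.add_apply, _root_.smul_apply,
        smul_eq_mul]
      ring
    simp only [e1, e2]
    rw [integral_add (integrable_mul_inner hu.continuousOn hφ' _)
        ((integrable_mul_inner hz.continuousOn hφ' _).const_mul c),
      integral_add (integrable_mul_form hv1 h1.continuous w)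
        ((integrable_mul_form hy1 h1.continuous w).const_mul c),
      integral_const_mul, integral_const_mul, hv3 φ h1 h2 h3 w, hy3 φ h1 h2 h3 w]

lemma isWeakSol_const {T : ℝ} (hT : 0 < T) {v : V} (hv : ∀ w, P.a v w = 0) :
    P.IsWeakSol T (P.j v) (fun _ => P.j v) := by
  refine ⟨continuousOn_const, rfl, fun _ => v, memLp_Ioo_of_continuous continuous_const T,
    Eventually.of_forall fun _ => rfl, fun φ h1 _ h3 w => ?_⟩
  have := integral_Ioo_deriv_smul_add hT h1 h3 (K := fun _ => inner ℝ (P.j v) (P.j w))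
    (k := fun _ => 0) (fun t => hasDerivAt_const t _) continuous_const
  simpa [hv] using this

lemma IsResolvent.eq_zero {l : ℝ} {R : H →L[ℝ] V} (hR : P.IsResolvent l R) (hl : 0 < l) {h : H}
    (h0 : P.j (R h) = 0) : h = 0 := by
  have h1 := hR.form_eq hl h (R h)
  rw [h0, inner_zero_right] at h1
  have h3 := P.coercive (R h)
  rw [h1, h0, norm_zero] at h3
  have h5 : ‖R h‖ ^ 2 = 0 :=
    le_antisymm (by simpa using nonpos_of_mul_nonpos_right h3 P.α_pos) (sq_nonneg _)
  have h6 : R h = 0 := by simpa using h5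
  refine P.eq_zero_of_inner h fun w => ?_
  rw [← hR h w, h6]; simp

/-- Let `z = j (R u)` with `l = 1`. Weakly `z' = -k`, where `k = u - z` is continuous, so `z = -K`
for the primitive `K` of `k` vanishing at 0. Then `(‖K‖²)' = 2 (K, k) = -2 a (R u) (R u) ≤ 0`; thus
`K = 0`, and `u = 0` because `j R` is injective. -/
lemma IsWeakSol.eq_zero {T : ℝ} (hT : 0 < T) {u : ℝ → H} (hu : P.IsWeakSol T 0 u) :
    ∀ t ∈ Icc 0 T, u t = 0 := by
  obtain ⟨R, hR⟩ := P.exists_isResolvent one_pos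
  obtain ⟨v, hv1, hv2, hv3⟩ := hu.weak
  -- Extended by its end values, `k` is continuous on the line, so its primitive is differentiable
  -- everywhere.
  set k : ℝ → H := IccExtend hT.le ((Icc 0 T).domRestrict fun t => u t - P.j (R (u t)))
  have hz : ContinuousOn (fun t => P.j (R (u t))) (Icc 0 T) :=
    P.j.continuous.comp_continuousOn (R.continuous.comp_continuousOn hu.continuousOn)
  have hk : Continuous k := (hu.continuousOn.sub hz).domRestrict.Icc_extend'
  have hkeq : ∀ t ∈ Icc 0 T, k t = u t - P.j (R (u t)) := fun t ht =>
    IccExtend_of_mem hT.le _ ht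
  set K : ℝ → H := fun t => ∫ s in (0 : ℝ)..t, k s
  have hK : ∀ t, HasDerivAt K (k t) t := fun t =>
    intervalIntegral.integral_hasDerivAt_right (hk.intervalIntegrable _ _)
      (hk.stronglyMeasurableAtFilter _ _) hk.continuousAt
  have hKc : Continuous K := continuous_iff_continuousAt.2 fun t => (hK t).continuousAt
  have hconst := eq_of_integral_deriv_smul_eq_zero hT
    (F := fun t => P.j (R (u t)) + K t) (hz.add hKc.continuousOn) fun φ h1 h2 h3 => by
      have hφ' : Continuous (deriv φ) := h1.continuous_deriv (by simp)
      have hi : IntegrableOn (fun t => deriv φ t • (P.j (R (u t)) + K t)) (Ioo 0 T) :=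
        ((hφ'.continuousOn.smul (hz.add hKc.continuousOn)).integrableOn_compact
          isCompact_Icc).mono_set Ioo_subset_Icc_self
      refine ext_inner_left ℝ fun g => ?_
      rw [inner_zero_right, ← integral_inner hi]
      -- The adjoint solution moves the resolvent onto the test vector: `(z, g) = (u, j w)`, and `a
      -- (v t) w = (k t, g)` for almost every `t`.
      obtain ⟨w, hw⟩ := P.exists_adjoint_solution one_pos g
      have e0 := integral_Ioo_deriv_smul_add hT h1 h3 (K := fun t => inner ℝ (K t) g)
        (k := fun t => inner ℝ (k t) g)
        (fun t => by simpa using (hK t).inner ℝ (hasDerivAt_const t g)) (hk.inner continuous_const)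
      simp only [smul_eq_mul] at e0
      rw [integral_add (integrable_mul_inner hKc.continuousOn hφ' g)
        (integrable_mul_inner hk.continuousOn h1.continuous g)] at e0
      have e1 : ∀ t, inner ℝ (P.j (R (u t))) g = inner ℝ (u t) (P.j w) := fun t => by
        rw [← hw, hR]
      have e2 : ∫ t in Ioo 0 T, φ t * P.a (v t) w = ∫ t in Ioo 0 T, φ t * inner ℝ (k t) g := by
        refine integral_congr_ae ?_
        filter_upwards [hv2, ae_restrict_mem measurableSet_Ioo] with t e3 e4
        have e5 := hw (v t)
        rw [e3, one_mul] at e5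
        rw [hkeq t (Ioo_subset_Icc_self e4), inner_sub_left, e1, ← e5]
        ring
      have e3 : ∀ t, inner ℝ g (deriv φ t • (P.j (R (u t)) + K t))
          = deriv φ t * inner ℝ (u t) (P.j w) + deriv φ t * inner ℝ (K t) g := fun t => by
        rw [real_inner_comm, real_inner_smul_left, inner_add_left, e1, mul_add]
      simp only [e3]
      rw [integral_add (integrable_mul_inner hu.continuousOn hφ' _)
        (integrable_mul_inner hKc.continuousOn hφ' g), hv3 φ h1 h2 h3 w, e2, add_comm]
      exact e0
  have hK0 : K 0 = 0 := intervalIntegral.integral_same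
  have hzK : ∀ t ∈ Icc 0 T, P.j (R (u t)) = -K t := fun t ht => by
    have := hconst t ht
    rw [hu.initial, hK0, map_zero, map_zero, add_zero] at this
    exact eq_neg_of_add_eq_zero_left this
  have hanti : AntitoneOn (fun t => ‖K t‖ ^ 2) (Icc 0 T) := by
    refine antitoneOn_of_deriv_nonpos (convex_Icc 0 T) (hKc.norm.pow 2).continuousOn
      (fun t _ => (hK t).norm_sq.differentiableAt.differentiableWithinAt) fun t ht => ?_
    rw [interior_Icc] at ht
    have ht := Ioo_subset_Icc_self ht
    have e1 := hR.form_eq one_pos (u t) (R (u t))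
    have e2 : P.yosida 1 R (u t) = k t := by
      rw [hkeq t ht, ← smul_yosida one_pos, one_smul]
    rw [e2, hzK t ht, inner_neg_right, real_inner_comm] at e1
    have e3 := P.form_self_nonneg (R (u t))
    rw [(hK t).norm_sq.deriv]
    linarith
  intro t ht
  refine hR.eq_zero one_pos ?_
  have := hanti (left_mem_Icc.2 hT.le) ht ht.1
  simp only [hK0, norm_zero] at this
  have h0 : ‖K t‖ ^ 2 = 0 := le_antisymm (by simpa using this) (sq_nonneg _)
  rw [hzK t ht, neg_eq_zero]
  simpa using h0

lemma IsWeakSol.eqOn {T : ℝ} (hT : 0 < T) {u₀ : H} {u z : ℝ → H} (hu : P.IsWeakSol T u₀ u)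
    (hz : P.IsWeakSol T u₀ z) : ∀ t ∈ Icc 0 T, u t = z t := fun t ht => by
  have h := hu.add_smul hz (-1)
  rw [neg_one_smul, add_neg_cancel] at h
  have := h.eq_zero hT t ht
  rwa [neg_one_smul, add_neg_eq_zero] at this

end GelfandForm

/-! ### Existence: convergence of the Yosida approximations -/

lemma norm_toLp_sq_eq_integral {E : Type*} [NormedAddCommGroup E] [InnerProductSpace ℝ E]
    {μ : Measure ℝ} {f : ℝ → E} (hf : MemLp f 2 μ) : ‖hf.toLp f‖ ^ 2 = ∫ t, ‖f t‖ ^ 2 ∂μ := by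
  rw [← real_inner_self_eq_norm_sq, L2.inner_def]
  refine integral_congr_ae (hf.coeFn_toLp.mono fun t ht => ?_)
  beta_reduce
  rw [ht, real_inner_self_eq_norm_sq]

namespace GelfandForm

variable {V H : Type*} [NormedAddCommGroup V] [InnerProductSpace ℝ V] [CompleteSpace V]
  [NormedAddCommGroup H] [InnerProductSpace ℝ H] [CompleteSpace H] (P : GelfandForm V H)

lemma continuous_resolvent_flow (l : ℝ) (R : H →L[ℝ] V) (h : H) :
    Continuous fun t => R (P.flow l R t h) := R.continuous.comp (continuous_flow h)

/-- The function `t ↦ R (exp (-t A) h)` as an element of `L²(0, T; V)`. -/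
def path (T l : ℝ) (R : H →L[ℝ] V) (h : H) : Lp V 2 (volume.restrict (Ioo 0 T)) :=
  (memLp_Ioo_of_continuous (P.continuous_resolvent_flow l R h) T).toLp _

lemma path_sub (T l : ℝ) (R : H →L[ℝ] V) (h k : H) :
    P.path T l R h - P.path T l R k = P.path T l R (h - k) := by
  rw [path, path, ← MemLp.toLp_sub]
  refine MemLp.toLp_congr _ _ (Eventually.of_forall fun t => ?_)
  simp

variable {P} {l : ℕ → ℝ} {R : ℕ → H →L[ℝ] V}

lemma norm_path_le {T : ℝ} (hT : 0 ≤ T) {l : ℝ} {R : H →L[ℝ] V} (hl : 0 < l)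
    (hR : P.IsResolvent l R) (h : H) :
    ‖P.path T l R h‖ ≤ Real.sqrt (1 / (2 * P.α) + T) * ‖h‖ := by
  have hα := P.α_pos
  rw [← sq_le_sq₀ (norm_nonneg _) (by positivity), mul_pow, Real.sq_sqrt (by positivity), path,
    norm_toLp_sq_eq_integral, ← integral_Ioc_eq_integral_Ioo, ← intervalIntegral.integral_of_le hT]
  exact hR.integral_norm_sq_le hl hT h

/-- The bound depends on the two parameters only through their sum and not on `t`, which gives both
uniform convergence in `H` and convergence in `L²(0,T; V)`. -/
lemma exists_bound_of_regular (hl : ∀ n, 0 < l n) (hl0 : Tendsto l atTop (𝓝 0))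
    (hR : ∀ n, P.IsResolvent (l n) (R n)) {v : V} {g : H}
    (hg : ∀ w, P.a v w = inner ℝ g (P.j w)) (T : ℝ) :
    ∃ B : ℕ × ℕ → ℝ, Tendsto B atTop (𝓝 0) ∧ ∀ p, 0 ≤ B p ∧ ∀ t ∈ Icc 0 T,
      ‖P.flow (l p.1) (R p.1) t (P.j v) - P.flow (l p.2) (R p.2) t (P.j v)‖ ≤ B p ∧
      ‖R p.1 (P.flow (l p.1) (R p.1) t (P.j v)) - R p.2 (P.flow (l p.2) (R p.2) t (P.j v))‖
        ≤ B p := by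
  set s : ℕ × ℕ → ℝ := fun p => l p.1 + l p.2
  have hs : Tendsto s atTop (𝓝 0) := by
    rw [← prod_atTop_atTop_eq]
    simpa using (hl0.comp tendsto_fst).add (hl0.comp tendsto_snd)
  have hs0 : ∀ p, 0 < s p := fun p => add_pos (hl _) (hl _)
  have hα := P.α_pos
  -- `c` bounds the distance of the flows plus the resolvent error; the root in `b` is the resulting
  -- bound in `V`, with `ε = c`.
  set c : ℝ → ℝ := fun x => Real.sqrt (4 * ‖g‖ ^ 2 * x * T) + x * ‖g‖
  set b : ℝ → ℝ := fun x => c x + Real.sqrt ((P.α * c x ^ 2 + 2 * ‖g‖ * c x) / P.α)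
  have hb : Continuous b := by simp only [b, c]; fun_prop
  have hb0 : b 0 = 0 := by simp [b, c]
  refine ⟨fun p => b (s p), ?_, fun p => ?_⟩
  · have := (hb.tendsto 0).comp hs
    rwa [hb0] at this
  have hc0 : 0 ≤ c (s p) := by have := hs0 p; positivity
  refine ⟨by positivity, fun t ht => ?_⟩
  have e1 : ‖P.flow (l p.1) (R p.1) t (P.j v) - P.flow (l p.2) (R p.2) t (P.j v)‖
      + (l p.1 + l p.2) * ‖g‖ ≤ c (s p) := by
    refine add_le_add_left ?_ _
    refine Real.le_sqrt_of_sq_le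
      (((hR _).norm_flow_sub_sq_le (hl _) (hR _) (hl _) hg ht.1).trans ?_)
    have := hs0 p
    exact mul_le_mul_of_nonneg_left ht.2 (by positivity)
  have e2 := (hR _).norm_resolvent_flow_sub_sq_le (hl _) (hR _) (hl _) hg ht.1 e1
  have e3 : 0 ≤ (l p.1 + l p.2) * ‖g‖ := mul_nonneg (hs0 p).le (norm_nonneg _)
  constructor
  · simp only [b]
    linarith [Real.sqrt_nonneg ((P.α * c (s p) ^ 2 + 2 * ‖g‖ * c (s p)) / P.α)]
  · refine le_add_of_nonneg_of_le hc0 (Real.le_sqrt_of_sq_le ?_)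
    rwa [le_div_iff₀' hα]

lemma exists_forall_ge {p : ℕ × ℕ → Prop} (h : ∀ᶠ x in atTop, p x) :
    ∃ N, ∀ m ≥ N, ∀ n ≥ N, p (m, n) := by
  obtain ⟨N, hN⟩ := eventually_atTop_prod_self.1 h
  exact ⟨N, fun m hm n hn => hN m n hm hn⟩

lemma uniformCauchySeqOn_flow (hl : ∀ n, 0 < l n) (hl0 : Tendsto l atTop (𝓝 0))
    (hR : ∀ n, P.IsResolvent (l n) (R n)) (h : H) (T : ℝ) :
    UniformCauchySeqOn (fun n t => P.flow (l n) (R n) t h) atTop (Icc 0 T) := by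
  rw [Metric.uniformCauchySeqOn_iff]
  intro ε hε
  obtain ⟨v, g, hg, hv⟩ := P.exists_regular_near h (ε := ε / 3) (by positivity)
  obtain ⟨B, hB, hB'⟩ := exists_bound_of_regular hl hl0 hR hg T
  obtain ⟨N, hN⟩ := exists_forall_ge (hB.eventually (gt_mem_nhds (show (0 : ℝ) < ε / 3 by positivity)))
  refine ⟨N, fun m hm n hn t ht => ?_⟩
  have e1 := ((hB' (m, n)).2 t ht).1
  have e2 := hN m hm n hn
  have e3 := (hR m).norm_flow_le (hl m) ht.1 (h - P.j v)
  have e4 := (hR n).norm_flow_le (hl n) ht.1 (h - P.j v)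
  dsimp only at e1
  rw [dist_eq_norm]
  calc ‖P.flow (l m) (R m) t h - P.flow (l n) (R n) t h‖
      = ‖P.flow (l m) (R m) t (h - P.j v) - P.flow (l n) (R n) t (h - P.j v)
        + (P.flow (l m) (R m) t (P.j v) - P.flow (l n) (R n) t (P.j v))‖ := by
        rw [map_sub, map_sub]; congr 1; abel
    _ ≤ ‖P.flow (l m) (R m) t (h - P.j v)‖ + ‖P.flow (l n) (R n) t (h - P.j v)‖
        + ‖P.flow (l m) (R m) t (P.j v) - P.flow (l n) (R n) t (P.j v)‖ :=
        (norm_add_le _ _).trans (add_le_add_left (norm_sub_le _ _) _)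
    _ < ε := by linarith

/-- The difference is the flow of `l A_l h`, of norm at most `l ‖g‖` for regular data and `2 ‖h‖` in
general. It makes the limits of the flows and of their resolvents agree under `j`. -/
lemma tendsto_sub_resolvent_flow (hl : ∀ n, 0 < l n) (hl0 : Tendsto l atTop (𝓝 0))
    (hR : ∀ n, P.IsResolvent (l n) (R n)) (h : H) {t : ℝ} (ht : 0 ≤ t) :
    Tendsto (fun n => P.flow (l n) (R n) t h - P.j (R n (P.flow (l n) (R n) t h))) atTop (𝓝 0) := by
  rw [Metric.tendsto_atTop]
  intro ε hε
  obtain ⟨v, g, hg, hv⟩ := P.exists_regular_near h (ε := ε / 3) (by positivity)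
  have hlg : Tendsto (fun n => l n * ‖g‖) atTop (𝓝 0) := by simpa using hl0.mul_const ‖g‖
  obtain ⟨N, hN⟩ := eventually_atTop.1
    (hlg.eventually (gt_mem_nhds (show (0 : ℝ) < ε / 3 by positivity)))
  refine ⟨N, fun n hn => ?_⟩
  have e1 : ∀ k, P.flow (l n) (R n) t k - P.j (R n (P.flow (l n) (R n) t k))
      = l n • P.flow (l n) (R n) t (P.yosida (l n) (R n) k) := fun k => by
    rw [← smul_yosida (hl n), yosida_flow]
  have e2 : ∀ k, ‖l n • P.yosida (l n) (R n) k‖ ≤ 2 * ‖k‖ := fun k => by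
    rw [smul_yosida (hl n)]
    exact (norm_sub_le _ _).trans (by linarith [(hR n).norm_le (hl n) k])
  have e3 : ‖l n • P.yosida (l n) (R n) (P.j v)‖ ≤ l n * ‖g‖ := by
    rw [norm_smul, Real.norm_of_nonneg (hl n).le]
    exact mul_le_mul_of_nonneg_left ((hR n).norm_yosida_le (hl n) hg) (hl n).le
  have e4 := hN n hn
  have e5 := e2 (h - P.j v)
  rw [dist_zero_right, e1, ← map_smul]
  calc ‖P.flow (l n) (R n) t (l n • P.yosida (l n) (R n) h)‖
      ≤ ‖l n • P.yosida (l n) (R n) h‖ := (hR n).norm_flow_le (hl n) ht _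
    _ = ‖l n • P.yosida (l n) (R n) (h - P.j v) + l n • P.yosida (l n) (R n) (P.j v)‖ := by
        rw [← smul_add, ← map_add, sub_add_cancel]
    _ ≤ _ := norm_add_le _ _
    _ < ε := by linarith

lemma cauchySeq_path (hl : ∀ n, 0 < l n) (hl0 : Tendsto l atTop (𝓝 0))
    (hR : ∀ n, P.IsResolvent (l n) (R n)) (h : H) {T : ℝ} (hT : 0 ≤ T) :
    CauchySeq fun n => P.path T (l n) (R n) h := by
  rw [Metric.cauchySeq_iff]
  intro ε hε
  have hα := P.α_pos
  set C := Real.sqrt (1 / (2 * P.α) + T)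
  have hC : 0 < C := Real.sqrt_pos.2 (by positivity)
  obtain ⟨v, g, hg, hv⟩ := P.exists_regular_near h (ε := ε / (3 * C)) (by positivity)
  obtain ⟨B, hB, hB'⟩ := exists_bound_of_regular hl hl0 hR hg T
  have hBT : Tendsto (fun p => B p * Real.sqrt T) atTop (𝓝 0) := by
    simpa using hB.mul_const (Real.sqrt T)
  obtain ⟨N, hN⟩ := exists_forall_ge
    (hBT.eventually (gt_mem_nhds (show (0 : ℝ) < ε / 3 by positivity)))
  refine ⟨N, fun m hm n hn => ?_⟩
  have e1 := norm_path_le hT (hl m) (hR m) (h - P.j v)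
  have e2 := norm_path_le hT (hl n) (hR n) (h - P.j v)
  have e3 : C * ‖h - P.j v‖ < ε / 3 := by
    have := mul_lt_mul_of_pos_left hv hC
    rwa [show C * (ε / (3 * C)) = ε / 3 by field_simp] at this
  have e4 : ‖P.path T (l m) (R m) (P.j v) - P.path T (l n) (R n) (P.j v)‖
      ≤ B (m, n) * Real.sqrt T := by
    have hB0 := (hB' (m, n)).1
    rw [← sq_le_sq₀ (norm_nonneg _) (by positivity), mul_pow, Real.sq_sqrt hT, path, path,
      ← MemLp.toLp_sub, norm_toLp_sq_eq_integral, ← integral_Ioc_eq_integral_Ioo,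
      ← intervalIntegral.integral_of_le hT]
    have : B (m, n) ^ 2 * T = ∫ t in (0 : ℝ)..T, B (m, n) ^ 2 := by simp [mul_comm]
    rw [this]
    refine intervalIntegral.integral_mono_on hT
      (Continuous.intervalIntegrable (((P.continuous_resolvent_flow _ _ _).sub
        (P.continuous_resolvent_flow _ _ _)).norm.pow 2) _ _)
      (continuous_const.intervalIntegrable _ _) fun t ht => ?_
    exact pow_le_pow_left₀ (norm_nonneg _) ((hB' (m, n)).2 t ht).2 2
  have e5 := hN m hm n hn
  rw [dist_eq_norm]
  calc ‖P.path T (l m) (R m) h - P.path T (l n) (R n) h‖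
      = ‖P.path T (l m) (R m) (h - P.j v) - P.path T (l n) (R n) (h - P.j v)
        + (P.path T (l m) (R m) (P.j v) - P.path T (l n) (R n) (P.j v))‖ := by
        rw [← path_sub, ← path_sub]; congr 1; abel
    _ ≤ ‖P.path T (l m) (R m) (h - P.j v)‖ + ‖P.path T (l n) (R n) (h - P.j v)‖
        + ‖P.path T (l m) (R m) (P.j v) - P.path T (l n) (R n) (P.j v)‖ :=
        (norm_add_le _ _).trans (add_le_add_left (norm_sub_le _ _) _)
    _ < ε := by linarith

lemma integral_deriv_mul_inner_flow {l : ℝ} {R : H →L[ℝ] V} (hl : 0 < l) (hR : P.IsResolvent l R)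
    (h : H) {T : ℝ} (hT : 0 < T) {φ : ℝ → ℝ} (hφ : ContDiff ℝ ∞ φ) (hs : tsupport φ ⊆ Ioo 0 T)
    (w : V) :
    ∫ t in Ioo 0 T, deriv φ t * inner ℝ (P.flow l R t h) (P.j w)
      = ∫ t in Ioo 0 T, φ t * P.a (R (P.flow l R t h)) w := by
  have hφ' : Continuous (deriv φ) := hφ.continuous_deriv (by simp)
  have hc := (P.continuous_resolvent_flow l R h)
  have h0 := integral_Ioo_deriv_smul_add hT hφ hs
    (K := fun t => inner ℝ (P.flow l R t h) (P.j w)) (k := fun t => -P.a (R (P.flow l R t h)) w)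
    (fun t => by
      have := (hasDerivAt_flow (P := P) (l := l) (R := R) t h).inner ℝ (hasDerivAt_const t (P.j w))
      rwa [inner_zero_right, zero_add, inner_neg_left, ← hR.form_eq hl] at this)
    ((P.a.flip w).continuous.comp hc).neg
  simp only [smul_eq_mul, mul_neg, ← sub_eq_add_neg] at h0
  rw [integral_sub (integrable_mul_inner (continuous_flow h).continuousOn hφ' _)
    (integrable_mul_form (memLp_Ioo_of_continuous hc T) hφ.continuous w), sub_eq_zero] at h0
  exact h0

variable (P)

theorem exists_isWeakSol (u₀ : H) : ∃ u : ℝ → H, ∀ T, 0 < T → P.IsWeakSol T u₀ u := by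
  set l : ℕ → ℝ := fun n => 1 / ((n : ℝ) + 1)
  have hl : ∀ n, 0 < l n := fun n => by positivity
  have hl0 : Tendsto l atTop (𝓝 0) := tendsto_one_div_add_atTop_nhds_zero_nat
  choose R hR using fun n => P.exists_isResolvent (hl n)
  -- Limits are chosen pointwise in `t`, so that one function serves every `T`; values at negative
  -- times are irrelevant.
  have hex : ∀ t : ℝ, ∃ x, 0 ≤ t → Tendsto (fun n => P.flow (l n) (R n) t u₀) atTop (𝓝 x) := by
    intro t
    by_cases ht : 0 ≤ t
    · obtain ⟨x, hx⟩ := cauchySeq_tendsto_of_complete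
        ((uniformCauchySeqOn_flow hl hl0 hR u₀ t).cauchySeq (right_mem_Icc.2 ht))
      exact ⟨x, fun _ => hx⟩
    · exact ⟨0, fun h => absurd h ht⟩
  choose u hu using hex
  refine ⟨u, fun T hT => ⟨?_, ?_, ?_⟩⟩
  · exact ((uniformCauchySeqOn_flow hl hl0 hR u₀ T).tendstoUniformlyOn_of_tendsto
      fun t ht => hu t ht.1).continuousOn
        (Frequently.of_forall fun n => (continuous_flow u₀).continuousOn)
  · refine tendsto_nhds_unique (hu 0 le_rfl) ?_
    simp
  obtain ⟨x, hx⟩ := cauchySeq_tendsto_of_complete (cauchySeq_path hl hl0 hR u₀ hT.le)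
  have hpath : ∀ n, P.path T (l n) (R n) u₀ =ᵐ[volume.restrict (Ioo 0 T)]
      fun t => R n (P.flow (l n) (R n) t u₀) := fun n => MemLp.coeFn_toLp _
  refine ⟨x, Lp.memLp x, ?_, fun φ h1 h2 h3 w => ?_⟩
  -- Convergence in `L²(0,T; V)` holds almost everywhere along a subsequence, which identifies `j (x
  -- t)` with `u t`.
  · obtain ⟨ns, hns, hns'⟩ := (tendstoInMeasure_of_tendsto_Lp hx).exists_seq_tendsto_ae
    filter_upwards [hns', ae_all_iff.2 hpath, ae_restrict_mem measurableSet_Ioo] with t e1 e2 e3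
    simp only [e2] at e1
    refine tendsto_nhds_unique ((P.j.continuous.tendsto _).comp e1) ?_
    have e4 := ((hu t e3.1.le).sub (tendsto_sub_resolvent_flow hl hl0 hR u₀ e3.1.le)).comp
      hns.tendsto_atTop
    simpa [Function.comp_def] using e4
  · have hφ' : Continuous (deriv φ) := h1.continuous_deriv (by simp)
    have hL : Tendsto (fun n => ∫ t in Ioo 0 T, deriv φ t * inner ℝ (P.flow (l n) (R n) t u₀) (P.j w))
        atTop (𝓝 (∫ t in Ioo 0 T, deriv φ t * inner ℝ (u t) (P.j w))) := by
      refine tendsto_integral_of_dominated_convergence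
        (fun t => |deriv φ t| * (‖u₀‖ * ‖P.j w‖)) (fun n => ?_) ?_ (fun n => ?_) ?_
      · exact (hφ'.mul ((continuous_flow u₀).inner continuous_const)).aestronglyMeasurable
      · exact (((hφ'.abs.mul continuous_const).continuousOn).integrableOn_compact
          isCompact_Icc).mono_set Ioo_subset_Icc_self
      · filter_upwards [ae_restrict_mem measurableSet_Ioo] with t ht
        rw [norm_mul, Real.norm_eq_abs]
        refine mul_le_mul_of_nonneg_left ((norm_inner_le_norm _ _).trans ?_) (abs_nonneg _)
        exact mul_le_mul_of_nonneg_right ((hR n).norm_flow_le (hl n) ht.1.le _) (norm_nonneg _)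
      · filter_upwards [ae_restrict_mem measurableSet_Ioo] with t ht
        exact ((hu t ht.1.le).inner tendsto_const_nhds).const_mul _
    -- The Riesz representative of `a · w` turns the right-hand side into an inner product with a
    -- fixed element of `L²(0,T; V)`, hence continuous in the path.
    set w' : V := (InnerProductSpace.toDual ℝ V).symm (P.a.flip w)
    have hw' : ∀ v, inner ℝ w' v = P.a v w := fun v => by
      simp only [w']; rw [InnerProductSpace.toDual_symm_apply]; rfl
    have hψ := memLp_Ioo_of_continuous (h1.continuous.smul (continuous_const (y := w'))) T
    have hinner : ∀ y : Lp V 2 (volume.restrict (Ioo 0 T)),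
        inner ℝ (hψ.toLp _) y = ∫ t in Ioo 0 T, φ t * P.a (y t) w := fun y => by
      rw [L2.inner_def]
      refine integral_congr_ae (hψ.coeFn_toLp.mono fun t ht => ?_)
      beta_reduce
      rw [ht, Pi.smul_apply', real_inner_smul_left, hw']
    refine tendsto_nhds_unique hL ?_
    rw [← hinner]
    have hlim := (tendsto_const_nhds (x := hψ.toLp _)).inner (𝕜 := ℝ) hx
    refine hlim.congr fun n => ?_
    rw [hinner, integral_deriv_mul_inner_flow (hl n) (hR n) u₀ hT h1 h3 w]
    refine integral_congr_ae ((hpath n).mono fun t ht => ?_)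
    beta_reduce
    rw [ht]

end GelfandForm

/-! ### Sobolev spaces and the form with constant coefficients -/

variable {Ω : Set Plane}

lemma continuous_partialDeriv {f : Plane → ℝ} (hf : ContDiff ℝ ∞ f) (k : Fin 2) :
    Continuous (partialDeriv k f) :=
  (hf.continuous_fderiv (by simp)).clm_apply continuous_const

lemma memLp_of_continuous_of_isBounded (hb : Bornology.IsBounded Ω) {f : Plane → ℝ}
    (hf : Continuous f) : MemLp f 2 (volume.restrict Ω) := by
  have hfin : IsFiniteMeasure (volume.restrict (closure Ω)) :=
    isFiniteMeasure_restrict.2 hb.closure.measure_lt_top.ne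
  obtain ⟨C, hC⟩ := hb.isCompact_closure.exists_bound_of_continuousOn hf.continuousOn
  have : MemLp f 2 (volume.restrict (closure Ω)) :=
    MemLp.of_bound hf.aestronglyMeasurable C
      ((ae_restrict_mem isClosed_closure.measurableSet).mono fun x hx => hC x hx)
  exact this.mono_measure (Measure.restrict_mono subset_closure le_rfl)

lemma IsTestFunction.setIntegral_mul_eq {φ ψ : Plane → ℝ} (hψ : tsupport ψ ⊆ Ω) :
    ∫ x in Ω, φ x * ψ x = ∫ x, φ x * ψ x :=
  setIntegral_eq_integral_of_forall_compl_eq_zero fun x hx => by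
    rw [image_eq_zero_of_notMem_tsupport fun h => hx (hψ h), mul_zero]

lemma IsTestFunction.integral_mul_partialDeriv {φ : Plane → ℝ} (hφ : IsTestFunction Ω φ)
    {f : Plane → ℝ} (hf : ContDiff ℝ ∞ f) (k : Fin 2) :
    ∫ x in Ω, f x * partialDeriv k φ x = -∫ x in Ω, partialDeriv k f x * φ x := by
  have hs : tsupport (partialDeriv k φ) ⊆ Ω :=
    (tsupport_fderiv_apply_subset ℝ (EuclideanSpace.single k 1)).trans hφ.support
  rw [setIntegral_mul_eq hs, setIntegral_mul_eq hφ.support]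
  refine integral_mul_fderiv_eq_neg_fderiv_mul_of_integrable ?_ ?_ ?_
    (fun x _ => (hf.differentiable (by simp)) x) (fun x _ => (hφ.smooth.differentiable (by simp)) x)
  · exact ((continuous_partialDeriv hf k).mul hφ.smooth.continuous).integrable_of_hasCompactSupport
      hφ.compact.mul_left
  · exact (hf.continuous.mul
      (continuous_partialDeriv hφ.smooth k)).integrable_of_hasCompactSupport
      (hφ.compact.fderiv_apply ℝ (EuclideanSpace.single k 1)).mul_left
  · exact (hf.continuous.mul hφ.smooth.continuous).integrable_of_hasCompactSupport
      hφ.compact.mul_left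

/-- A function that is smooth on the whole plane as an element of `H¹(Ω)`, for a bounded `Ω`. -/
def smoothH1 (hb : Bornology.IsBounded Ω) (f : Plane → ℝ) (hf : ContDiff ℝ ∞ f) : H1 Ω :=
  ⟨WithLp.toLp 2 ((memLp_of_continuous_of_isBounded hb hf.continuous).toLp f,
    WithLp.toLp 2 fun k =>
      (memLp_of_continuous_of_isBounded hb (continuous_partialDeriv hf k)).toLp (partialDeriv k f)),
    fun k φ hφ => by
      have e1 := (memLp_of_continuous_of_isBounded hb hf.continuous).coeFn_toLp
      have e2 := (memLp_of_continuous_of_isBounded hb (continuous_partialDeriv hf k)).coeFn_toLp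
      refine ((integral_congr_ae (e1.mono fun x hx => ?_)).trans
        (hφ.integral_mul_partialDeriv hf k)).trans
        (congrArg Neg.neg (integral_congr_ae (e2.mono fun x hx => ?_)))
      · exact congrArg (· * _) hx
      · exact congrArg (· * _) hx.symm⟩

/-- Each test function imposes an equality of two continuous functionals. Closedness yields the
completeness needed for Lax–Milgram. -/
lemma isClosed_H1 (Ω : Set Plane) :
    IsClosed (H1 Ω : Set (WithLp 2 (L2 Ω × PiLp 2 fun _ : Fin 2 => L2 Ω))) := by
  have hint : ∀ {ψ : Plane → ℝ}, MemLp ψ 2 (volume.restrict Ω) →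
      Continuous fun g : L2 Ω => ∫ x in Ω, g x * ψ x := by
    intro ψ hψ
    have : (fun g : L2 Ω => ∫ x in Ω, g x * ψ x) = fun g => inner ℝ (hψ.toLp ψ) g := by
      funext g
      rw [L2.inner_def]
      refine integral_congr_ae (hψ.coeFn_toLp.mono fun x hx => ?_)
      beta_reduce
      rw [hx]; simp
    rw [this]
    exact continuous_const.inner continuous_id
  have : (H1 Ω : Set (WithLp 2 (L2 Ω × PiLp 2 fun _ : Fin 2 => L2 Ω))) =
      ⋂ (k : Fin 2) (φ : Plane → ℝ) (_ : IsTestFunction Ω φ),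
        {p | ∫ x in Ω, p.fst x * partialDeriv k φ x = -∫ x in Ω, p.snd k x * φ x} := by
    ext p
    simp only [mem_iInter]
    rfl
  rw [this]
  refine isClosed_iInter fun k => isClosed_iInter fun φ => isClosed_iInter fun hφ => ?_
  have hc : Continuous (partialDeriv k φ) := continuous_partialDeriv hφ.smooth k
  have hs : HasCompactSupport (partialDeriv k φ) :=
    hφ.compact.fderiv_apply ℝ (EuclideanSpace.single k 1)
  refine isClosed_eq ((hint ((hc.memLp_of_hasCompactSupport hs).restrict Ω)).comp ?_)
    ((hint ((hφ.smooth.continuous.memLp_of_hasCompactSupport hφ.compact).restrict Ω)).comp ?_).neg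
  · fun_prop
  · fun_prop

instance (Ω : Set Plane) : CompleteSpace (H1 Ω) := (isClosed_H1 Ω).completeSpace_coe

lemma norm_sq_X1 (u : X1 Ω) :
    ‖u‖ ^ 2 = ‖u.toX0‖ ^ 2 + ∑ i, ∑ k, ‖(u i).1.snd k‖ ^ 2 := by
  have h : ∀ i, ‖u i‖ ^ 2 = ‖(u i).1.fst‖ ^ 2 + ∑ k, ‖(u i).1.snd k‖ ^ 2 := fun i => by
    rw [← PiLp.norm_sq_eq_of_L2, ← WithLp.prod_norm_sq_eq_of_L2]; rfl
  rw [PiLp.norm_sq_eq_of_L2, PiLp.norm_sq_eq_of_L2, ← Finset.sum_add_distrib]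
  exact Finset.sum_congr rfl fun i _ => h i

lemma norm_toX0_le (u : X1 Ω) : ‖u.toX0‖ ≤ ‖u‖ := by
  rw [← sq_le_sq₀ (norm_nonneg _) (norm_nonneg _), norm_sq_X1 u]
  exact le_add_of_nonneg_right (Finset.sum_nonneg fun _ _ => Finset.sum_nonneg fun _ _ => sq_nonneg _)

lemma norm_snd_le (u : X1 Ω) (i k : Fin 2) : ‖(u i).1.snd k‖ ≤ ‖u‖ := by
  rw [← sq_le_sq₀ (norm_nonneg _) (norm_nonneg _), norm_sq_X1 u]
  refine le_add_of_nonneg_of_le (sq_nonneg _) ?_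
  refine (Finset.single_le_sum (f := fun k => ‖(u i).1.snd k‖ ^ 2) (fun _ _ => sq_nonneg _)
    (Finset.mem_univ k)).trans ?_
  exact Finset.single_le_sum (f := fun i => ∑ k, ‖(u i).1.snd k‖ ^ 2)
    (fun _ _ => Finset.sum_nonneg fun _ _ => sq_nonneg _) (Finset.mem_univ i)

/-- The inclusion of `X₁` in `X₀` as a continuous linear map. -/
def embedding (Ω : Set Plane) : X1 Ω →L[ℝ] X0 Ω :=
  LinearMap.mkContinuous { toFun := X1.toX0, map_add' := fun _ _ => rfl, map_smul' := fun _ _ => rfl }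
    1 fun u => by rw [one_mul]; exact norm_toX0_le u

/-- The partial derivative `∂u_i/∂x_k` of an element of `X₁`. -/
def partialL (Ω : Set Plane) (i k : Fin 2) : X1 Ω →L[ℝ] L2 Ω :=
  LinearMap.mkContinuous
    { toFun := fun u => (u i).1.snd k, map_add' := fun _ _ => rfl, map_smul' := fun _ _ => rfl }
    1 fun u => by rw [one_mul]; exact norm_snd_le u i k

/-- The bilinear form of the system with the constant diffusion matrix `A`. -/
def constForm (Ω : Set Plane) (A : Matrix (Fin 2) (Fin 2) ℝ) : X1 Ω →L[ℝ] X1 Ω →L[ℝ] ℝ :=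
  ∑ k, ∑ i, ∑ l, A i l • (isBoundedBilinearMap_inner (𝕜 := ℝ)
    (E := L2 Ω)).toContinuousLinearMap.bilinearComp (partialL Ω l k) (partialL Ω i k)

lemma constForm_apply (A : Matrix (Fin 2) (Fin 2) ℝ) (u w : X1 Ω) :
    constForm Ω A u w = ∑ k, ∑ i, ∑ l, A i l * inner ℝ ((u l).1.snd k) ((w i).1.snd k) := by
  simp only [constForm, _root_.sum_apply, _root_.smul_apply, smul_eq_mul]
  rfl

lemma diffusionForm_const (A : Matrix (Fin 2) (Fin 2) ℝ) (u w : X1 Ω) :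
    diffusionForm (fun _ => A) u w = constForm Ω A u w := by
  have h : ∀ i l k, Integrable (fun x => A i l * inner ℝ ((u l).1.snd k x) ((w i).1.snd k x))
      (volume.restrict Ω) := fun i l k => (L2.integrable_inner _ _).const_mul _
  rw [constForm_apply]
  simp only [L2.inner_def, ← integral_const_mul]
  simp only [← integral_finsetSum _ fun l _ => h _ l _]
  simp only [← integral_finsetSum _ fun i _ => integrable_finsetSum _ fun l _ => h i l _]
  rw [← integral_finsetSum _ fun k _ => integrable_finsetSum _ fun i _ =>
    integrable_finsetSum _ fun l _ => h i l k]
  refine integral_congr_ae (Eventually.of_forall fun x => ?_)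
  simp only [Matrix.trace, Matrix.diag, Matrix.mul_apply, Matrix.transpose_apply, X1.jacobian,
    Matrix.of_apply, Fin.sum_univ_two, RCLike.inner_apply, conj_trivial]
  ring

/-- Pointwise, (H1) is applied to each column `(∂_k u_0, ∂_k u_1)` of the Jacobian: `A` mixes
components, not space directions. -/
lemma le_constForm_self {A : Matrix (Fin 2) (Fin 2) ℝ} {α : ℝ}
    (hA : ∀ ξ : Plane, α * ‖ξ‖ ^ 2 ≤ dotProduct ξ.ofLp (A.mulVec ξ.ofLp)) (u : X1 Ω) :
    α * ∑ i, ∑ k, ‖(u i).1.snd k‖ ^ 2 ≤ constForm Ω A u u := by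
  have h : ∀ i l k, Integrable (fun x => A i l * inner ℝ ((u l).1.snd k x) ((u i).1.snd k x))
      (volume.restrict Ω) := fun i l k => (L2.integrable_inner _ _).const_mul _
  have h' : ∀ i k, Integrable (fun x => inner ℝ ((u i).1.snd k x) ((u i).1.snd k x))
      (volume.restrict Ω) := fun i k => L2.integrable_inner _ _
  rw [constForm_apply, Finset.sum_comm, Finset.mul_sum]
  refine Finset.sum_le_sum fun k _ => ?_
  simp only [← real_inner_self_eq_norm_sq, L2.inner_def, ← integral_const_mul]
  simp only [← integral_finsetSum _ fun l _ => h _ l _]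
  rw [← integral_finsetSum _ fun i _ => integrable_finsetSum _ fun l _ => h i l k,
    ← integral_finsetSum _ fun i _ => h' i k, ← integral_const_mul]
  refine integral_mono ((integrable_finsetSum _ fun i _ => h' i k).const_mul _)
    (integrable_finsetSum _ fun i _ => integrable_finsetSum _ fun l _ => h i l k) fun x => ?_
  have := hA (WithLp.toLp 2 ![(u 0).1.snd k x, (u 1).1.snd k x])
  rw [PiLp.norm_sq_eq_of_L2] at this
  simp only [Fin.sum_univ_two, dotProduct, Matrix.mulVec, Matrix.cons_val_zero, Matrix.cons_val_one,
    Real.norm_eq_abs, sq_abs] at this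
  simp only [Fin.sum_univ_two, RCLike.inner_apply, conj_trivial]
  linarith

/-- Testing with a smooth compactly supported function in one component reduces this to the
fundamental lemma of the calculus of variations. -/
lemma eq_zero_of_inner_embedding (hΩ : IsOpen Ω) (hb : Bornology.IsBounded Ω) {h : X0 Ω}
    (h0 : ∀ w : X1 Ω, inner ℝ h (embedding Ω w) = 0) : h = 0 := by
  ext1 i
  have key : ∀ᵐ x, x ∈ Ω → (h i : Plane → ℝ) x = 0 := by
    refine hΩ.ae_eq_zero_of_integral_contDiff_smul_eq_zero ?_ fun φ h1 h2 h3 => ?_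
    · exact (show LocallyIntegrableOn (h i : Plane → ℝ) Ω volume from
        IntegrableOn.locallyIntegrableOn (by
          have : IsFiniteMeasure (volume.restrict Ω) :=
            isFiniteMeasure_restrict.2 hb.measure_lt_top.ne
          exact (Lp.memLp (h i)).integrable (by norm_num)))
    · have e := h0 (WithLp.toLp 2 (Pi.single i (smoothH1 hb φ h1)))
      have e1 : inner ℝ h (embedding Ω (WithLp.toLp 2 (Pi.single i (smoothH1 hb φ h1))))
          = inner ℝ (h i) (smoothH1 hb φ h1).1.fst := by
        rw [PiLp.inner_apply, Finset.sum_eq_single i]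
        · change inner ℝ (h i) ((Pi.single i (smoothH1 hb φ h1) : Fin 2 → H1 Ω) i).1.fst = _
          rw [Pi.single_eq_same]
        · intro b _ hbi
          change inner ℝ (h b) ((Pi.single i (smoothH1 hb φ h1) : Fin 2 → H1 Ω) b).1.fst = _
          rw [Pi.single_eq_of_ne hbi]
          exact inner_zero_right _
        · simp
      rw [e1, L2.inner_def] at e
      have e2 : ∫ x, φ x • (h i : Plane → ℝ) x = ∫ x in Ω, φ x • (h i : Plane → ℝ) x :=
        (setIntegral_eq_integral_of_forall_compl_eq_zero fun x hx => by
          rw [image_eq_zero_of_notMem_tsupport fun h' => hx (h3 h'), zero_smul]).symm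
      rw [e2, ← e]
      refine integral_congr_ae
        ((memLp_of_continuous_of_isBounded hb h1.continuous).coeFn_toLp.mono fun x hx => ?_)
      change φ x * h i x = inner ℝ (h i x) _
      rw [← hx]
      rfl
  refine (Lp.eq_zero_iff_ae_eq_zero).2 ?_
  rw [EventuallyEq, ae_restrict_iff' hΩ.measurableSet]
  exact key

lemma GelfandForm.memLp_form {V H : Type*} [NormedAddCommGroup V] [InnerProductSpace ℝ V]
    [NormedAddCommGroup H] [InnerProductSpace ℝ H] (P : GelfandForm V H) {μ : Measure ℝ}
    {v : ℝ → V} (hv : MemLp v 2 μ) : MemLp (fun t => -P.a (v t)) 2 μ :=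
  (P.a.comp_memLp' hv).neg

/-- The system with a constant coercive diffusion matrix `A`. -/
def constGelfandForm (hΩ : IsOpen Ω) (hb : Bornology.IsBounded Ω) {A : Matrix (Fin 2) (Fin 2) ℝ}
    {α : ℝ} (hα : 0 < α)
    (hA : ∀ ξ : Plane, α * ‖ξ‖ ^ 2 ≤ dotProduct ξ.ofLp (A.mulVec ξ.ofLp)) :
    GelfandForm (X1 Ω) (X0 Ω) where
  j := embedding Ω
  a := constForm Ω A
  α := α
  α_pos := hα
  norm_j_le := norm_toX0_le
  coercive u := by
    refine le_trans (le_of_eq ?_) (le_constForm_self hA u)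
    rw [norm_sq_X1 u]
    congr 1
    exact add_sub_cancel_left _ _
  eq_zero_of_inner _ := eq_zero_of_inner_embedding hΩ hb

/-- The equation determines the time derivative as `f t = -a (v t)`, which is in `L²` because `a` is
bounded; so `f` can be eliminated. -/
lemma isWeakSolution_iff (hΩ : IsOpen Ω) (hb : Bornology.IsBounded Ω)
    {A : Matrix (Fin 2) (Fin 2) ℝ} {α : ℝ} (hα : 0 < α)
    (hA : ∀ ξ : Plane, α * ‖ξ‖ ^ 2 ≤ dotProduct ξ.ofLp (A.mulVec ξ.ofLp)) {T : ℝ} {u₀ : X0 Ω}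
    {u : ℝ → X0 Ω} : IsWeakSolution (fun _ => A) T u₀ u
      ↔ (constGelfandForm hΩ hb hα hA).IsWeakSol T u₀ u := by
  constructor
  · rintro ⟨h1, h2, v, f, h3, h4, _, h6, h7⟩
    refine ⟨h1, h2, v, h3, h4, fun φ e1 e2 e3 w => ?_⟩
    refine (h6 φ e1 e2 e3 w).trans ?_
    rw [← integral_neg]
    refine integral_congr_ae (h7.mono fun t ht => ?_)
    have e := ht w
    rw [diffusionForm_const] at e
    change -(φ t * f t w) = φ t * constForm Ω A (v t) w
    rw [eq_neg_of_add_eq_zero_left e]; ring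
  · rintro ⟨h1, h2, v, h3, h4, h5⟩
    refine ⟨h1, h2, v, fun t => -constForm Ω A (v t), h3, h4,
      (constGelfandForm hΩ hb hα hA).memLp_form h3, fun φ e1 e2 e3 w => ?_, Eventually.of_forall fun t w => ?_⟩
    · refine (h5 φ e1 e2 e3 w).trans ?_
      rw [← integral_neg]
      refine integral_congr_ae (Eventually.of_forall fun t => ?_)
      change φ t * constForm Ω A (v t) w = -(φ t * -constForm Ω A (v t) w)
      ring
    · rw [diffusionForm_const]
      exact neg_add_cancel _

/-- A constant vector as an element of `X₁`. -/
def constX1 (hb : Bornology.IsBounded Ω) (C : Plane) : X1 Ω :=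
  WithLp.toLp 2 fun i => smoothH1 hb (fun _ => C i) contDiff_const

lemma constForm_constX1 (hb : Bornology.IsBounded Ω) (A : Matrix (Fin 2) (Fin 2) ℝ) (C : Plane)
    (w : X1 Ω) : constForm Ω A (constX1 hb C) w = 0 := by
  have h : ∀ i k, (constX1 hb C i).1.snd k = 0 := fun i k => by
    refine Lp.eq_zero_iff_ae_eq_zero.2 ((memLp_of_continuous_of_isBounded hb
      (continuous_partialDeriv contDiff_const k)).coeFn_toLp.trans (Eventually.of_forall fun x => ?_))
    simp [partialDeriv]
  rw [constForm_apply]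
  simp only [h, inner_zero_left, mul_zero, Finset.sum_const_zero]

end CrossDiffusion

end

/-! ### Well-posedness and grey-level shift invariance -/

theorem lemma1 {Ω : Set CrossDiffusion.Plane} (hΩ : IsOpen Ω) (hb : Bornology.IsBounded Ω)
    (D : CrossDiffusion.Plane → Matrix (Fin 2) (Fin 2) ℝ)
    (hH1 : ∃ α : ℝ, 0 < α ∧ ∀ y ξ : CrossDiffusion.Plane,
      α * ‖ξ‖ ^ 2 ≤ dotProduct ξ.ofLp ((D y).mulVec ξ.ofLp))
    (hH2 : ∃ L : ℝ, 0 < L ∧ ∀ (y z : CrossDiffusion.Plane) (i j : Fin 2),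
      |D z i j - D y i j| ≤ L * ‖z - y‖)
    (hH3 : ∃ M : ℝ, 0 < M ∧ ∀ (y : CrossDiffusion.Plane) (i j : Fin 2), |D y i j| ≤ M)
    (hshift : ∀ y C : CrossDiffusion.Plane, D (y + C) = D y) :
    -- the operator is well defined: it gives the unique weak solution
    (∀ u₀ : CrossDiffusion.X0 Ω, ∀ T : ℝ, 0 < T →
      CrossDiffusion.IsWeakSolution D T u₀ (fun t => CrossDiffusion.scaleSpace D t u₀) ∧
      ∀ u : ℝ → CrossDiffusion.X0 Ω, CrossDiffusion.IsWeakSolution D T u₀ u →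
        ∀ t ∈ Set.Icc 0 T, u t = CrossDiffusion.scaleSpace D t u₀) ∧
    (∀ t : ℝ, 0 ≤ t → CrossDiffusion.scaleSpace D t (0 : CrossDiffusion.X0 Ω) = 0) ∧
    (∀ t : ℝ, 0 ≤ t → ∀ (u₀ : CrossDiffusion.X0 Ω) (C : CrossDiffusion.Plane),
      CrossDiffusion.scaleSpace D t (u₀ + CrossDiffusion.constField hb C)
        = CrossDiffusion.scaleSpace D t u₀ + CrossDiffusion.constField hb C) := by
  obtain ⟨α, hα, hcoer⟩ := hH1
  obtain ⟨A, rfl⟩ : ∃ A, D = fun _ => A := ⟨D 0, funext fun y => by simpa using hshift 0 y⟩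
  have hA := hcoer 0
  have hiff := fun (T : ℝ) (u₀ : CrossDiffusion.X0 Ω) (u : ℝ → CrossDiffusion.X0 Ω) =>
    CrossDiffusion.isWeakSolution_iff hΩ hb hα hA (T := T) (u₀ := u₀) (u := u)
  have hsol : ∀ (u₀ : CrossDiffusion.X0 Ω) (T : ℝ), 0 < T →
      CrossDiffusion.IsWeakSolution (fun _ => A) T u₀
        (fun t => CrossDiffusion.scaleSpace (fun _ => A) t u₀) := by
    intro u₀
    obtain ⟨u, hu⟩ := (CrossDiffusion.constGelfandForm hΩ hb hα hA).exists_isWeakSol u₀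
    have hex : ∃ u : ℝ → CrossDiffusion.X0 Ω, ∀ T : ℝ, 0 < T →
        CrossDiffusion.IsWeakSolution (fun _ => A) T u₀ u :=
      ⟨u, fun T hT => (hiff T u₀ u).2 (hu T hT)⟩
    simp only [CrossDiffusion.scaleSpace, dif_pos hex]
    exact hex.choose_spec
  have huniq : ∀ (u₀ : CrossDiffusion.X0 Ω) (T : ℝ), 0 < T → ∀ u : ℝ → CrossDiffusion.X0 Ω,
      CrossDiffusion.IsWeakSolution (fun _ => A) T u₀ u →
        ∀ t ∈ Set.Icc 0 T, u t = CrossDiffusion.scaleSpace (fun _ => A) t u₀ :=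
    fun u₀ T hT u hu =>
      ((hiff T u₀ u).1 hu).eqOn hT ((hiff T u₀ _).1 (hsol u₀ T hT))
  refine ⟨fun u₀ T hT => ⟨hsol u₀ T hT, huniq u₀ T hT⟩, fun t ht => ?_, fun t ht u₀ C => ?_⟩
  -- The interval `[0, t + 1]` has positive length even for `t = 0`.
  · have hT : 0 < t + 1 := by linarith
    have hzero := (CrossDiffusion.constGelfandForm hΩ hb hα hA).isWeakSol_const hT (v := 0)
      fun z => by rw [map_zero, _root_.zero_apply]
    rw [map_zero] at hzero
    exact (huniq 0 (t + 1) hT _ ((hiff _ _ _).2 hzero) t ⟨ht, by linarith⟩).symm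
  · have hT : 0 < t + 1 := by linarith
    have hconst := (CrossDiffusion.constGelfandForm hΩ hb hα hA).isWeakSol_const hT
      (CrossDiffusion.constForm_constX1 hb A C)
    -- The image of `constX1 hb C` under the embedding is `constField hb C` by definition, so the
    -- sum has the shifted initial datum.
    have hsum := ((hiff _ _ _).1 (hsol u₀ (t + 1) hT)).add_smul hconst 1
    simp only [one_smul] at hsum
    exact (huniq _ (t + 1) hT _ ((hiff _ _ _).2 hsum) t ⟨ht, by linarith⟩).symm
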